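/- Let $I$ be an index set, $n_\alpha\ge 1$ integers, $\mathcal A_\alpha=M_{n_\alpha}(\mathbb C)$ with identity $e_\alpha$, $\mathcal A_0=\bigoplus_{\alpha\in I}\mathcal A_\alpha$ (algebraic direct sum) and $\mathcal A$ its norm closure. Let $\mathcal A$ be a discrete quantum group, that is, let $\Delta:\mathcal M(\mathcal A)\to\mathcal M(\mathcal A\otimes\mathcal A)$ be a unital $*$-homomorphism such that $a\otimes b\mapsto\Delta(a)(1\otimes b)$ and $a\otimes b\mapsto(a\otimes1)\Delta(b)$ define bijections of $\mathcal A_0\otimes_{\rm alg}\mathcal A_0$ and such that $\Delta$ is coassociative. Let $\alpha_0\in I$ be the index of the one-dimensional block whose identity $h_0$ satisfies $h_0a=ah_0=\epsilon(a)h_0$ for $a\in\mathcal A_0$, where $\epsilon$ is the counit, and let $\phi$ be the left Haar measure on $\mathcal A_0$ (the positive faithful functional with $(\mathrm{id}\otimes\phi)((b\otimes1)\Delta(a))=\phi(a)b$), normalized by $\phi(h_0)=1$. For a finite subset $F\subseteq I$ put $e_F=\sum_{\alpha\in F}e_\alpha$, let $\sigma$ be the flip, and let $\mathcal E_F$ be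 the universal C*-algebra generated by elements $\lambda(a)$, $a\in\mathcal A_0$, such that (i) $\lambda$ is linear and completely positive; (ii) for all $n$ and all $a,b\in\mathcal A_0$ with $(1\otimes e_F)\,\sigma(\Delta(a))\,(b\otimes1)=0$ one has $(\lambda\otimes\mathrm{id})(\Delta^n(a))(\lambda\otimes\mathrm{id})(\Delta^n(x_1))\cdots(\lambda\otimes\mathrm{id})(\Delta^n(x_k))(\lambda\otimes\mathrm{id})(\Delta^n(b))=0$ for all $x_1,\dots,x_k\in\mathcal A_0$, where $\Delta^n:\mathcal M(\mathcal A)\to\mathcal M(\mathcal A^{\otimes(n+1)})$ is the iterated comultiplication; (iii) $\sum_\alpha\lambda(e_\alpha)\lambda(a)=\lambda(a)$ for all $a\in\mathcal A_0$. For a coassociative $*$-homomorphism $\delta:\mathcal C\to\mathcal M(\mathcal C\otimes\mathcal A)$ on a C*-algebra $\mathcal C$ and a $*$-subalgebra $\mathcal C_0\subseteq\mathcal C$ consider the conditions A1: $\delta(c)(c'\otimes1)\in\mathcal C_0\otimes_{\rm alg}\mathcal A_0$ for all $c,c'\in\mathcal C_0$; A2: $\delta(c)(1\otimes a)\in\mathcal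 C_0\otimes_{\rm alg}\mathcal A_0$ for all $c\in\mathcal C_0$, $a\in\mathcal A_0$; A3: there is a positive $h\in\mathcal C_0$ with $(\mathrm{id}\otimes\phi)(\delta(h^2))=1$, where $(\mathrm{id}\otimes\phi)(X)$ is the strict limit in $\mathcal M(\mathcal C)$ of $(\mathrm{id}\otimes\phi)(X(1\otimes e_J))$ over the finite subsets $J\subseteq I$. **Theorem.** Let $F$ be a finite subset of $I$ containing $\alpha_0$. There is a unique $*$-homomorphism $\Delta_F:\mathcal E_F\to\mathcal M(\mathcal E_F\otimes\mathcal A)$ with $\Delta_F(\lambda(a))=(\lambda\otimes\mathrm{id})(\Delta(a))$ for all $a\in\mathcal A_0$. It is coassociative, and A1, A2, A3 are valid for $\Delta_F$: there is a dense $*$-subalgebra $\mathcal C_0$ of $\mathcal E_F$ that satisfies A1, A2 and A3; it can be chosen to contain the (dense) $*$-algebra $\mathcal C_0'$ generated by the $\lambda(a)$, $a\in\mathcal A_0$, and the element $h$ of A3 can be chosen with $h^2=\lambda(h_0)$. Moreover $\mathcal C_0'$ itself satisfies A1 and A2, and $\lambda(h_0)\in\mathcal C_0'$ is a positive element with $(\mathrm{id}\otimes\phi)(\Delta_F(\lambda(h_0)))=1$.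 -/

import Mathlib

open scoped ENNReal MultiplierAlgebra

universe u

noncomputable section

/-! ### Bounded families of matrices -/

section Bounded

variable {J : Type u} (m : J → Type) [∀ j, Fintype (m j)] [∀ j, DecidableEq (m j)]
variable (B : Type*) [CStarAlgebra B]

/-- The unique C⋆-norm on the matrix algebra `M_m(B)` over a C⋆-algebra `B`. -/
def matNorm {k : Type} [Fintype k] (X : Matrix k k B) : ℝ :=
  letI := CStarAlgebra.spectralOrder B
  haveI := CStarAlgebra.spectralOrderedRing B
  ‖CStarMatrix.ofMatrix X‖

/-- The `*`-algebra of norm-bounded families `(X_j)`, `X_j ∈ M_{m j}(B)`, that is the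
`ℓ^∞`-product of the C⋆-algebras `M_{m j}(B)`. It is the multiplier algebra of the `c₀`-direct sum
of these algebras if `B` is unital, and the multiplier algebra of `⨁_j C ⊗ M_{m j}(ℂ)` if
`B = 𝓜(ℂ, C)`. -/
def BddFam : StarSubalgebra ℂ (∀ j, Matrix (m j) (m j) B) where
  carrier := {X | ∃ K : ℝ, ∀ j, matNorm B (X j) ≤ K}
  mul_mem' := by
    let _ := CStarAlgebra.spectralOrder B
    have := CStarAlgebra.spectralOrderedRing B
    rintro X Y ⟨K, hK⟩ ⟨L, hL⟩
    refine ⟨K * L, fun j => ?_⟩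
    have h := norm_mul_le (CStarMatrix.ofMatrix (X j)) (CStarMatrix.ofMatrix (Y j))
    exact h.trans (mul_le_mul (hK j) (hL j) (norm_nonneg _) ((norm_nonneg _).trans (hK j)))
  add_mem' := by
    let _ := CStarAlgebra.spectralOrder B
    have := CStarAlgebra.spectralOrderedRing B
    rintro X Y ⟨K, hK⟩ ⟨L, hL⟩
    exact ⟨K + L, fun j => (norm_add_le (CStarMatrix.ofMatrix (X j))
      (CStarMatrix.ofMatrix (Y j))).trans (add_le_add (hK j) (hL j))⟩
  algebraMap_mem' := by
    let _ := CStarAlgebra.spectralOrder B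
    have := CStarAlgebra.spectralOrderedRing B
    intro r
    refine ⟨‖r‖ * 1, fun j => ?_⟩
    have h1 : ‖(1 : CStarMatrix (m j) (m j) B)‖ ≤ 1 := by
      have h := CStarRing.norm_star_mul_self (x := (1 : CStarMatrix (m j) (m j) B))
      rw [star_one, one_mul] at h
      nlinarith [norm_nonneg (1 : CStarMatrix (m j) (m j) B)]
    have h2 : ‖r • (1 : CStarMatrix (m j) (m j) B)‖ ≤ ‖r‖ * 1 := by
      rw [norm_smul]
      exact mul_le_mul_of_nonneg_left h1 (norm_nonneg r)
    have h3 : (algebraMap ℂ (∀ j, Matrix (m j) (m j) B) r) j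
        = r • (1 : Matrix (m j) (m j) B) := by
      rw [Pi.algebraMap_apply, Algebra.algebraMap_eq_smul_one]
    rw [h3]
    exact h2
  star_mem' := by
    let _ := CStarAlgebra.spectralOrder B
    have := CStarAlgebra.spectralOrderedRing B
    rintro X ⟨K, hK⟩
    refine ⟨K, fun j => ?_⟩
    have h := norm_star (CStarMatrix.ofMatrix (X j))
    exact (le_of_eq h).trans (hK j)

end Bounded

/-! ### Direct sums of matrix algebras -/

section DirectSum

variable {I : Type u} (n : I → ℕ)

/-- The algebraic direct sum `A₀ = ⨁_α M_{n α}(ℂ)`: the finitely supported families, as a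
`*`-subalgebra of the algebraic multipliers `∏_α M_{n α}(ℂ)`. -/
def AlgSum : NonUnitalStarSubalgebra ℂ (∀ α, Matrix (Fin (n α)) (Fin (n α)) ℂ) where
  carrier := {a | {α | a α ≠ 0}.Finite}
  add_mem' := by
    intro a b ha hb
    refine (ha.union hb).subset fun α h => ?_
    by_contra hc
    simp only [Set.mem_union, Set.mem_ofPred_eq, not_or, not_not] at hc
    exact h (by rw [Pi.add_apply, hc.1, hc.2, add_zero])
  zero_mem' := by simp
  mul_mem' := by
    intro a b ha _
    refine Set.Finite.subset ha fun α h hc => h ?_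
    rw [Pi.mul_apply, hc, zero_mul]
  smul_mem' := by
    intro r a ha
    refine Set.Finite.subset ha fun α h hc => h ?_
    rw [Pi.smul_apply, hc, smul_zero]
  star_mem' := by
    intro a ha
    refine Set.Finite.subset ha fun α h hc => h ?_
    rw [Pi.star_apply, hc, star_zero]

variable {n}

open Classical in
/-- The element of `A₀` that is `x` in the component `α` and `0` elsewhere. -/
def AlgSum.single (α : I) (x : Matrix (Fin (n α)) (Fin (n α)) ℂ) : AlgSum n :=
  ⟨Pi.single α x, (Set.finite_singleton α).subset fun β h => by
    by_contra hc
    exact h (Pi.single_eq_of_ne (M := fun α => Matrix (Fin (n α)) (Fin (n α)) ℂ) hc x)⟩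

/-- The identity `e_α` of the block `α`. -/
def AlgSum.e (α : I) : AlgSum n := AlgSum.single α 1

/-- The matrix unit `e^α_{ij}`. -/
def AlgSum.unit (α : I) (i j : Fin (n α)) : AlgSum n := AlgSum.single α (Matrix.single i j 1)

/-- The inclusion of `A₀` into `M(A₀)`, the bounded families. -/
def AlgSum.toM (a : AlgSum n) : BddFam (fun α => Fin (n α)) ℂ :=
  ⟨a.1, by
    let _ := CStarAlgebra.spectralOrder ℂ
    have := CStarAlgebra.spectralOrderedRing ℂ
    have hfin : {α | a.1 α ≠ 0}.Finite := a.2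
    refine ⟨∑ α ∈ hfin.toFinset, matNorm ℂ (a.1 α), fun α => ?_⟩
    have hnn : ∀ β, 0 ≤ matNorm ℂ (a.1 β) := fun β =>
      norm_nonneg (CStarMatrix.ofMatrix (a.1 β))
    by_cases h : a.1 α = 0
    · have h0 : matNorm ℂ (a.1 α) = 0 := by
        rw [h]
        exact norm_zero (E := CStarMatrix (Fin (n α)) (Fin (n α)) ℂ)
      rw [h0]
      exact Finset.sum_nonneg fun β _ => hnn β
    · exact Finset.single_le_sum (f := fun α => matNorm ℂ (a.1 α)) (fun β _ => hnn β)
        (hfin.mem_toFinset.2 h)⟩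

end DirectSum

/-! ### Discrete quantum groups -/

/-- A unital `*`-homomorphism `Δ : M(A₀) → M(A₀ ⊗ A₀)` with `Δ(a)(1 ⊗ b)` and `(a ⊗ 1)Δ(b)` in
`A₀ ⊗_alg A₀` for `a, b ∈ A₀`. The block `A_α ⊗ A_β` of `A₀ ⊗ A₀` is the algebra of matrices
indexed by `Fin (n α) × Fin (n β)`, with `x ⊗ y` the Kronecker product. -/
structure Comultiplication (I : Type u) where
  /-- the sizes of the blocks -/
  n : I → ℕ
  n_pos : ∀ α, 0 < n α
  /-- the comultiplication -/
  Δ : BddFam (fun α => Fin (n α)) ℂ →⋆ₐ[ℂ]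
    BddFam (fun p : I × I => Fin (n p.1) × Fin (n p.2)) ℂ
  finite_T₁ : ∀ a b : AlgSum n, {p : I × I |
    (Δ (AlgSum.toM a)).1 p * Matrix.kronecker (1 : Matrix (Fin (n p.1)) (Fin (n p.1)) ℂ) (b.1 p.2)
      ≠ 0}.Finite
  finite_T₂ : ∀ a b : AlgSum n, {p : I × I |
    Matrix.kronecker (a.1 p.1) (1 : Matrix (Fin (n p.2)) (Fin (n p.2)) ℂ) * (Δ (AlgSum.toM b)).1 p
      ≠ 0}.Finite

namespace Comultiplication

variable {I : Type u} (G : Comultiplication I)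

/-- The pre-C⋆-algebra `A₀`. -/
abbrev A₀ : Type u := AlgSum G.n

/-- `Δ(a)` for `a ∈ A₀`, as the family of its components in `A_α ⊗ A_β`. -/
def com (a : G.A₀) (α β : I) :
    Matrix (Fin (G.n α) × Fin (G.n β)) (Fin (G.n α) × Fin (G.n β)) ℂ :=
  (G.Δ (AlgSum.toM a)).1 (α, β)

theorem com_add (a b : G.A₀) (α β : I) : G.com (a + b) α β = G.com a α β + G.com b α β := by
  have h : AlgSum.toM (a + b) = (AlgSum.toM a) + (AlgSum.toM b) := rfl
  simp only [com, h, map_add]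
  rfl

theorem com_smul (r : ℂ) (a : G.A₀) (α β : I) : G.com (r • a) α β = r • G.com a α β := by
  have h : AlgSum.toM (r • a) = r • (AlgSum.toM a) := rfl
  simp only [com, h, map_smul]
  rfl

/-- The algebraic multipliers of `A₀ ⊗ A₀`. -/
abbrev MAlg₂ : Type u :=
  ∀ p : I × I, Matrix (Fin (G.n p.1) × Fin (G.n p.2)) (Fin (G.n p.1) × Fin (G.n p.2)) ℂ

/-- `Δ(a)(1 ⊗ b)`. -/
def T₁fun (a b : G.A₀) : G.MAlg₂ := fun p =>
  G.com a p.1 p.2 * Matrix.kronecker (1 : Matrix (Fin (G.n p.1)) (Fin (G.n p.1)) ℂ) (b.1 p.2)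

/-- `(a ⊗ 1)Δ(b)`. -/
def T₂fun (a b : G.A₀) : G.MAlg₂ := fun p =>
  Matrix.kronecker (a.1 p.1) (1 : Matrix (Fin (G.n p.2)) (Fin (G.n p.2)) ℂ) * G.com b p.1 p.2

open scoped TensorProduct

/-- The linear map `T₁` on `A₀ ⊗_alg A₀`, `a ⊗ b ↦ Δ(a)(1 ⊗ b)`. -/
def T₁ : G.A₀ ⊗[ℂ] G.A₀ →ₗ[ℂ] G.MAlg₂ :=
  TensorProduct.lift (LinearMap.mk₂ ℂ G.T₁fun
    (fun a a' b => by funext p; simp [T₁fun, com_add, add_mul])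
    (fun r a b => by funext p; simp [T₁fun, com_smul])
    (fun a b b' => by
      funext p; simp [T₁fun, Matrix.kronecker, Matrix.kroneckerMap_add_right, mul_add])
    (fun r a b => by
      funext p
      simp [T₁fun, Matrix.kronecker, Matrix.kroneckerMap_smul_right (fun x y : ℂ => x * y) r
        (fun x y => mul_left_comm x r y)]))

/-- The linear map `T₂` on `A₀ ⊗_alg A₀`, `a ⊗ b ↦ (a ⊗ 1)Δ(b)`. -/
def T₂ : G.A₀ ⊗[ℂ] G.A₀ →ₗ[ℂ] G.MAlg₂ :=
  TensorProduct.lift (LinearMap.mk₂ ℂ G.T₂fun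
    (fun a a' b => by
      funext p; simp [T₂fun, Matrix.kronecker, Matrix.kroneckerMap_add_left, add_mul])
    (fun r a b => by
      funext p
      simp [T₂fun, Matrix.kronecker, Matrix.kroneckerMap_smul_left (fun x y : ℂ => x * y) r
        (fun x y => mul_assoc r x y)])
    (fun a b b' => by funext p; simp [T₂fun, com_add, mul_add])
    (fun r a b => by funext p; simp [T₂fun, com_smul]))

/-- The finitely supported families in `∏ A_α ⊗ A_β`, that is `A₀ ⊗_alg A₀`. -/
def finSupp₂ : Set G.MAlg₂ := {Y | {p | Y p ≠ 0}.Finite}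

/-- For `Δ(b)(1 ⊗ e_γ) = ∑_{kk'} b_{kk'} ⊗ e^γ_{kk'}`, the element `b_{kk'}` of `A₀`. -/
def leg₁ (γ : I) (k k' : Fin (G.n γ)) : G.A₀ →ₗ[ℂ] G.A₀ where
  toFun b := ⟨fun α => Matrix.of fun i i' => G.com b α γ (i, k) (i', k'), by
    refine ((G.finite_T₁ b (AlgSum.e γ)).image Prod.fst).subset fun α h => ?_
    refine ⟨(α, γ), fun hc => h ?_, rfl⟩
    have he : (AlgSum.e γ : G.A₀).1 γ = 1 := by simp [AlgSum.e, AlgSum.single]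
    have h0 : G.com b α γ = 0 := by
      have hc' : G.com b α γ * Matrix.kronecker (1 : Matrix (Fin (G.n α)) (Fin (G.n α)) ℂ)
        ((AlgSum.e γ : G.A₀).1 γ) = 0 := hc
      rw [he] at hc'
      simpa [Matrix.kronecker] using hc'
    funext i i'
    simp [h0]⟩
  map_add' a b := by
    apply Subtype.ext; funext α i i'; simp [com_add]
  map_smul' r a := by
    apply Subtype.ext; funext α i i'; simp [com_smul]

/-- For `(e_α ⊗ 1)Δ(b) = ∑_{ii'} e^α_{ii'} ⊗ b_{ii'}`, the element `b_{ii'}` of `A₀`. -/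
def leg₂ (α : I) (i i' : Fin (G.n α)) : G.A₀ →ₗ[ℂ] G.A₀ where
  toFun b := ⟨fun γ => Matrix.of fun k k' => G.com b α γ (i, k) (i', k'), by
    refine ((G.finite_T₂ (AlgSum.e α) b).image Prod.snd).subset fun γ h => ?_
    refine ⟨(α, γ), fun hc => h ?_, rfl⟩
    have he : (AlgSum.e α : G.A₀).1 α = 1 := by simp [AlgSum.e, AlgSum.single]
    have h0 : G.com b α γ = 0 := by
      have hc' : Matrix.kronecker ((AlgSum.e α : G.A₀).1 α)
        (1 : Matrix (Fin (G.n γ)) (Fin (G.n γ)) ℂ) * G.com b α γ = 0 := hc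
      rw [he] at hc'
      simpa [Matrix.kronecker] using hc'
    funext k k'
    simp [h0]⟩
  map_add' a b := by
    apply Subtype.ext; funext α i i'; simp [com_add]
  map_smul' r a := by
    apply Subtype.ext; funext α i i'; simp [com_smul]

/-- Discrete quantum groups: `T₁`, `T₂` are bijections of `A₀ ⊗_alg A₀` and `Δ` is coassociative.
In `coassoc` the left side is the component of `(Δ ⊗ id)(Δ(b)(1 ⊗ e_γ))` in
`A_α ⊗ A_β ⊗ A_γ`, the right side that of `(id ⊗ Δ)((e_α ⊗ 1)Δ(b))`. -/
structure IsDiscreteQuantumGroup : Prop where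
  T₁_injective : Function.Injective G.T₁
  T₁_range : Set.range G.T₁ = G.finSupp₂
  T₂_injective : Function.Injective G.T₂
  T₂_range : Set.range G.T₂ = G.finSupp₂
  coassoc : ∀ (b : G.A₀) (α β γ : I) (i i' : Fin (G.n α)) (j j' : Fin (G.n β))
    (k k' : Fin (G.n γ)),
    G.com (G.leg₁ γ k k' b) α β (i, j) (i', j') = G.com (G.leg₂ α i i' b) β γ (j, k) (j', k')

/-- The counit: `(ε ⊗ id)Δ = id = (id ⊗ ε)Δ` on `A₀`, `ε` a `*`-homomorphism. -/
def IsCounit (ε : G.A₀ →⋆ₙₐ[ℂ] ℂ) : Prop :=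
  ∀ (b : G.A₀) (γ : I) (k k' : Fin (G.n γ)),
    ε (G.leg₁ γ k k' b) = b.1 γ k k' ∧ ε (G.leg₂ γ k k' b) = b.1 γ k k'

/-- `α₀` is the index of the one-dimensional block whose identity `h₀` satisfies
`h₀ a = a h₀ = ε(a) h₀`. -/
def IsCounitIndex (α₀ : I) : Prop :=
  G.n α₀ = 1 ∧ ∃ ε : G.A₀ →⋆ₙₐ[ℂ] ℂ, G.IsCounit ε ∧ ∀ a : G.A₀,
    AlgSum.e α₀ * a = ε a • AlgSum.e α₀ ∧ a * AlgSum.e α₀ = ε a • AlgSum.e α₀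

/-- A left Haar measure: a positive faithful functional `φ` on `A₀` that is left invariant,
`(id ⊗ φ)((b ⊗ 1)Δ(a)) = φ(a) b`. -/
structure IsLeftHaar (φ : G.A₀ →ₗ[ℂ] ℂ) : Prop where
  nonneg : ∀ a : G.A₀, 0 ≤ (φ (star a * a)).re ∧ (φ (star a * a)).im = 0
  faithful : ∀ a : G.A₀, φ (star a * a) = 0 → a = 0
  invariant : ∀ (a b : G.A₀) (β : I),
    b.1 β * Matrix.of (fun i i' => φ (G.leg₂ β i i' a)) = φ a • b.1 β

/-! ### The universal C⋆-algebra `E_F` -/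

/-- For a linear map `l : A₀ → B`, the component in `B ⊗ A_β = M_{n β}(B)` of the map
`(l ⊗ id) ∘ Δ`. -/
def tilde {B : Type*} [NonUnitalRing B] [Module ℂ B] (l : G.A₀ →ₗ[ℂ] B) (β : I) :
    G.A₀ →ₗ[ℂ] Matrix (Fin (G.n β)) (Fin (G.n β)) B where
  toFun a := Matrix.of fun k k' => l (G.leg₁ β k k' a)
  map_add' a b := by ext k k'; simp
  map_smul' r a := by ext k k'; simp

/-- `(1 ⊗ e_F)(σ(Δ(a)))(b ⊗ 1) = 0`, that is `(e_F ⊗ 1)Δ(a)(1 ⊗ b) = 0`. -/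
def FOrth (F : Finset I) (a b : G.A₀) : Prop :=
  ∀ β ∈ F, ∀ γ : I, G.T₁fun a b (β, γ) = 0

/-- `(l ⊗ id)(Δⁿ(a)) (l ⊗ id)(Δⁿ(x₁)) ⋯ (l ⊗ id)(Δⁿ(x_k)) (l ⊗ id)(Δⁿ(b)) = 0` for all
`x₁, …, x_k ∈ A₀` and all `a, b` with `(1 ⊗ e_F)(σ(Δ(a)))(b ⊗ 1) = 0`. As
`(l ⊗ id) ∘ Δⁿ⁺¹ = (l' ⊗ id) ∘ Δⁿ` for `l' = (l ⊗ id) ∘ Δ`, the condition for `n + 1` is the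
one for `n`, for the components of `l'`. -/
def Vanishes (F : Finset I) : ℕ → ∀ {B : Type u} [NonUnitalRing B] [Module ℂ B],
    (G.A₀ →ₗ[ℂ] B) → Prop
  | 0, _, _, _, l => ∀ a b : G.A₀, G.FOrth F a b → ∀ xs : List G.A₀,
      xs.foldl (fun z x => z * l x) (l a) * l b = 0
  | n + 1, _, _, _, l => ∀ β : I, Vanishes F n (G.tilde l β)

/-- The relations that define `E_F`, for a linear map `l` of `A₀` into a C⋆-algebra. -/
structure Relations (F : Finset I) {B : Type u} [NonUnitalCStarAlgebra B]
    (l : G.A₀ →ₗ[ℂ] B) : Prop where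
  /-- `l` is completely positive: the amplifications to matrices map elements `Y* Y` to
  positive elements, which are the elements `Z* Z`. -/
  cp : ∀ (m : ℕ) (Y : Matrix (Fin m) (Fin m) G.A₀), ∃ Z : Matrix (Fin m) (Fin m) B,
    (Y.conjTranspose * Y).map l = Z.conjTranspose * Z
  vanish : ∀ n : ℕ, G.Vanishes F n l
  sum : ∀ a : G.A₀, HasSum (fun α => l (AlgSum.e α) * l a) (l a)

/-- The value at `l` of a noncommutative polynomial in the elements of `A₀`, without constant
term. -/
def polyEval {B : Type u} [NonUnitalCStarAlgebra B] (l : G.A₀ →ₗ[ℂ] B)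
    (p : FreeSemigroup G.A₀ →₀ ℂ) : B :=
  p.sum fun w z => z • FreeSemigroup.lift (fun a => l a) w

/-- The C⋆-seminorms `p ↦ ‖p(l)‖` on polynomials that come from maps `l` of `A₀` into a C⋆-algebra
that satisfy the relations. They form a set, and two maps with the same seminorm generate isomorphic
C⋆-algebras. -/
def RepNorm (F : Finset I) : Type u :=
  {s : (FreeSemigroup G.A₀ →₀ ℂ) → ℝ // ∃ (B : Type u) (_ : NonUnitalCStarAlgebra B)
    (l : G.A₀ →ₗ[ℂ] B), G.Relations F l ∧ ∀ p, s p = ‖G.polyEval l p‖}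

section Bound

variable {G} {F : Finset I} {B : Type u} [NonUnitalCStarAlgebra B] {l : G.A₀ →ₗ[ℂ] B}

theorem Relations.exists_star_mul (h : G.Relations F l) (y : G.A₀) :
    ∃ z : B, l (star y * y) = star z * z := by
  obtain ⟨Z, hZ⟩ := h.cp 1 (Matrix.of fun _ _ => y)
  refine ⟨Z 0 0, ?_⟩
  have := congrFun (congrFun hZ 0) 0
  simpa [Matrix.mul_apply] using this

theorem e_star_mul (α : I) : star (AlgSum.e α : G.A₀) * AlgSum.e α = AlgSum.e α := by
  classical
  apply Subtype.ext
  funext β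
  by_cases hβ : β = α
  · subst hβ
    simp [AlgSum.e, AlgSum.single]
  · have h0 : (AlgSum.e α : G.A₀).1 β = 0 :=
      Pi.single_eq_of_ne (M := fun α => Matrix (Fin (G.n α)) (Fin (G.n α)) ℂ) hβ 1
    change star ((AlgSum.e α : G.A₀).1 β) * (AlgSum.e α : G.A₀).1 β = _
    rw [h0]
    simp

theorem Relations.norm_e_le (h : G.Relations F l) (α : I) : ‖l (AlgSum.e α)‖ ≤ 1 := by
  classical
  let _ := CStarAlgebra.spectralOrder B
  have := CStarAlgebra.spectralOrderedRing B
  have hpos : ∀ β, 0 ≤ l (AlgSum.e β) := fun β => by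
    obtain ⟨z, hz⟩ := h.exists_star_mul (AlgSum.e β)
    rw [e_star_mul] at hz
    rw [hz]
    exact star_mul_self_nonneg z
  set b := l (AlgSum.e α) with hb
  have hsa : star b = b := (hpos α).isSelfAdjoint
  have hs : HasSum (fun β => b * (l (AlgSum.e β) * b)) (b * b) :=
    (h.sum (AlgSum.e α)).mul_left b
  have hle : b * (b * b) ≤ b * b := by
    refine le_hasSum hs α fun β _ => ?_
    have := star_left_conjugate_nonneg (hpos β) b
    rwa [hsa, mul_assoc] at this
  have hnn : 0 ≤ b * (b * b) := by
    have := star_left_conjugate_nonneg (hpos α) b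
    rwa [hsa, mul_assoc] at this
  have h1 : ‖b * (b * b)‖ ≤ ‖b * b‖ := CStarAlgebra.norm_le_norm_of_nonneg_of_le hnn hle
  have h2 : ‖b * b‖ = ‖b‖ * ‖b‖ := by
    have := CStarRing.norm_star_mul_self (x := b)
    rwa [hsa] at this
  have h3 : ‖(b * b) * (b * b)‖ = ‖b * b‖ * ‖b * b‖ := by
    have := CStarRing.norm_star_mul_self (x := b * b)
    rwa [star_mul, hsa] at this
  have h4 : ‖(b * b) * (b * b)‖ ≤ ‖b‖ * ‖b * (b * b)‖ := by
    rw [mul_assoc]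
    exact norm_mul_le _ _
  by_contra hc
  push Not at hc
  have h5 : ‖b‖ * ‖b * (b * b)‖ ≤ ‖b‖ * (‖b‖ * ‖b‖) := by
    rw [← h2]
    exact mul_le_mul_of_nonneg_left h1 (norm_nonneg b)
  rw [h3, h2] at h4
  have h6 : 0 < ‖b‖ * (‖b‖ * ‖b‖) := by positivity
  nlinarith

variable (F) in
/-- The values at `a` of all maps that satisfy the relations are bounded by one constant. -/
def IsBdd (a : G.A₀) : Prop :=
  ∃ K : ℝ, ∀ (B : Type u) [NonUnitalCStarAlgebra B] (l : G.A₀ →ₗ[ℂ] B),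
    G.Relations F l → ‖l a‖ ≤ K

theorem isBdd_e (α : I) : IsBdd F (AlgSum.e α : G.A₀) := ⟨1, fun _ _ _ h => h.norm_e_le α⟩

theorem IsBdd.add {a b : G.A₀} : IsBdd F a → IsBdd F b → IsBdd F (a + b) := by
  rintro ⟨K, hK⟩ ⟨L, hL⟩
  refine ⟨K + L, fun B _ l h => ?_⟩
  rw [map_add]
  exact (norm_add_le _ _).trans (add_le_add (hK B l h) (hL B l h))

theorem IsBdd.smul {a : G.A₀} (r : ℂ) : IsBdd F a → IsBdd F (r • a) := by
  rintro ⟨K, hK⟩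
  refine ⟨‖r‖ * K, fun B _ l h => ?_⟩
  rw [map_smul, norm_smul]
  exact mul_le_mul_of_nonneg_left (hK B l h) (norm_nonneg r)

theorem isBdd_zero : IsBdd F (0 : G.A₀) := ⟨0, fun B _ l _ => by simp⟩

theorem IsBdd.sum {ι : Type*} (s : Finset ι) (f : ι → G.A₀) (hf : ∀ i ∈ s, IsBdd F (f i)) :
    IsBdd F (∑ i ∈ s, f i) := by
  classical
  induction s using Finset.induction_on with
  | empty => simpa using isBdd_zero
  | insert i s hi ih =>
    rw [Finset.sum_insert hi]
    exact (hf i (Finset.mem_insert_self i s)).add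
      (ih fun j hj => hf j (Finset.mem_insert_of_mem hj))

/-- Positive elements below a bounded one are bounded. -/
theorem IsBdd.of_add {x y : G.A₀}
    (h : IsBdd F (star x * x + star y * y)) : IsBdd F (star x * x) := by
  obtain ⟨K, hK⟩ := h
  refine ⟨K, fun B _ l hl => ?_⟩
  let _ := CStarAlgebra.spectralOrder B
  have := CStarAlgebra.spectralOrderedRing B
  refine le_trans ?_ (hK B l hl)
  obtain ⟨z, hz⟩ := hl.exists_star_mul x
  obtain ⟨w, hw⟩ := hl.exists_star_mul y
  refine CStarAlgebra.norm_le_norm_of_nonneg_of_le ?_ ?_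
  · rw [hz]
    exact star_mul_self_nonneg z
  · rw [map_add, hw]
    exact le_add_of_nonneg_right (star_mul_self_nonneg w)

theorem IsBdd.star_mul {x y : G.A₀} (hx : IsBdd F (star x * x)) (hy : IsBdd F (star y * y)) :
    IsBdd F (star x * y) := by
  have ex : ∀ r : ℂ, star (x + r • y) * (x + r • y) = star x * x + r • (star x * y)
      + star r • (star y * x) + (star r * r) • (star y * y) := by
    intro r
    rw [star_add, star_smul, add_mul, mul_add, mul_add, smul_mul_assoc, smul_mul_assoc,
      mul_smul_comm, mul_smul_comm, smul_smul]
    abel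
  have key : ∀ r : ℂ, star r * r = 1 → IsBdd F (star (x + r • y) * (x + r • y)) := by
    intro r hr
    refine IsBdd.of_add (y := x + (-r) • y) ?_
    have : star (x + r • y) * (x + r • y) + star (x + (-r) • y) * (x + (-r) • y)
        = (2 : ℂ) • (star x * x) + (2 : ℂ) • (star y * y) := by
      rw [ex, ex, star_neg, neg_mul_neg, hr]
      module
    rw [this]
    exact (hx.smul 2).add (hy.smul 2)
  have hI : Complex.I * Complex.I = -1 := Complex.I_mul_I
  have e1 : star x * y = (1 / 4 : ℂ) • (star (x + (1 : ℂ) • y) * (x + (1 : ℂ) • y))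
      + (-1 / 4 : ℂ) • (star (x + (-1 : ℂ) • y) * (x + (-1 : ℂ) • y))
      + (-Complex.I / 4 : ℂ) • (star (x + Complex.I • y) * (x + Complex.I • y))
      + (Complex.I / 4 : ℂ) • (star (x + (-Complex.I) • y) * (x + (-Complex.I) • y)) := by
    simp only [ex, star_one, star_neg, Complex.star_def, Complex.conj_I]
    match_scalars
    all_goals first
      | ring1
      | linear_combination (1 / 2 : ℂ) * hI
      | linear_combination (-1 / 2 : ℂ) * hI
  rw [e1]
  exact ((((key 1 (by simp)).smul _).add ((key (-1) (by simp)).smul _)).add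
    ((key Complex.I (by simp)).smul _)).add ((key (-Complex.I) (by simp)).smul _)

theorem IsBdd.all (a : G.A₀) : IsBdd F a := by
  classical
  have hsingle : ∀ (α : I) (X Y : Matrix (Fin (G.n α)) (Fin (G.n α)) ℂ),
      star (AlgSum.single α X : G.A₀) * AlgSum.single α Y = AlgSum.single α (star X * Y) := by
    intro α X Y
    apply Subtype.ext
    funext β
    change star ((AlgSum.single α X : G.A₀).1 β) * (AlgSum.single α Y : G.A₀).1 β = _
    by_cases hβ : β = α
    · subst hβ
      simp [AlgSum.single]
    · simp [AlgSum.single, Pi.single_eq_of_ne hβ]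
  have hadd : ∀ (α : I) (X Y : Matrix (Fin (G.n α)) (Fin (G.n α)) ℂ),
      (AlgSum.single α X : G.A₀) + AlgSum.single α Y = AlgSum.single α (X + Y) := by
    intro α X Y
    apply Subtype.ext
    exact (Pi.single_add (f := fun α => Matrix (Fin (G.n α)) (Fin (G.n α)) ℂ) α X Y).symm
  have hdiag : ∀ (α : I) (i j : Fin (G.n α)),
      IsBdd F (star (AlgSum.unit α i j : G.A₀) * AlgSum.unit α i j) := by
    intro α i j
    refine IsBdd.of_add (y := AlgSum.single α (1 - Matrix.single j j 1)) ?_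
    have h : star (AlgSum.unit α i j : G.A₀) * AlgSum.unit α i j
        + star (AlgSum.single α (1 - Matrix.single j j 1) : G.A₀)
          * AlgSum.single α (1 - Matrix.single j j 1) = AlgSum.e α := by
      rw [AlgSum.unit, hsingle, hsingle, hadd, AlgSum.e]
      congr 1
      simp [Matrix.star_eq_conjTranspose, sub_mul, mul_sub]
    rw [h]
    exact isBdd_e α
  have hunit : ∀ (α : I) (i j : Fin (G.n α)), IsBdd F (AlgSum.unit α i j : G.A₀) := by
    intro α i j
    have h : (AlgSum.unit α i j : G.A₀) = star (AlgSum.unit α i i) * AlgSum.unit α i j := by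
      simp only [AlgSum.unit, hsingle]
      congr 1
      simp [Matrix.star_eq_conjTranspose]
    rw [h]
    exact (hdiag α i i).star_mul (hdiag α i j)
  have hfin : {α | a.1 α ≠ 0}.Finite := a.2
  have hsum : a = ∑ α ∈ hfin.toFinset, ∑ i, ∑ j, a.1 α i j • (AlgSum.unit α i j : G.A₀) := by
    apply Subtype.ext
    funext β
    have hc : ∀ (s : Finset I) (f : I → G.A₀), (∑ α ∈ s, f α).1 β = ∑ α ∈ s, (f α).1 β := by
      intro s f
      rw [AddSubmonoidClass.coe_finsetSum, Finset.sum_apply]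
    have hblock : ∀ α, (∑ i, ∑ j, a.1 α i j • (AlgSum.unit α i j : G.A₀)).1
        = Pi.single α (a.1 α) := by
      intro α
      funext γ
      simp only [AddSubmonoidClass.coe_finsetSum, Finset.sum_apply]
      by_cases hγ : γ = α
      · subst hγ
        conv_rhs => rw [Pi.single_eq_same, Matrix.matrix_eq_sum_single (a.1 γ)]
        refine Finset.sum_congr rfl fun i _ => Finset.sum_congr rfl fun j _ => ?_
        change a.1 γ i j • (AlgSum.unit γ i j : G.A₀).1 γ = _
        simp [AlgSum.unit, AlgSum.single]
      · rw [Pi.single_eq_of_ne hγ]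
        refine Finset.sum_eq_zero fun i _ => Finset.sum_eq_zero fun j _ => ?_
        change a.1 α i j • (AlgSum.unit α i j : G.A₀).1 γ = _
        simp [AlgSum.unit, AlgSum.single, Pi.single_eq_of_ne hγ]
    rw [hc]
    simp only [hblock]
    by_cases hβ : a.1 β = 0
    · rw [hβ]
      refine (Finset.sum_eq_zero fun α _ => ?_).symm
      by_cases h : β = α
      · subst h
        rw [Pi.single_eq_same, hβ]
      · rw [Pi.single_eq_of_ne h]
    · rw [Finset.sum_eq_single β]
      · rw [Pi.single_eq_same]
      · intro α _ h
        rw [Pi.single_eq_of_ne (Ne.symm h)]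
      · intro h
        exact absurd (hfin.mem_toFinset.2 hβ) h
  rw [hsum]
  exact IsBdd.sum _ _ fun α _ => IsBdd.sum _ _ fun i _ => IsBdd.sum _ _ fun j _ =>
    (hunit α i j).smul _

end Bound

variable {G} {F : Finset I}

/-- The C⋆-algebra that carries a map with the given seminorm. -/
def RepNorm.Alg (s : G.RepNorm F) : Type u := s.2.choose

instance (s : G.RepNorm F) : NonUnitalCStarAlgebra s.Alg := s.2.choose_spec.choose

/-- A map with the given seminorm. -/
def RepNorm.map (s : G.RepNorm F) : G.A₀ →ₗ[ℂ] s.Alg := s.2.choose_spec.choose_spec.choose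

theorem RepNorm.relations (s : G.RepNorm F) : G.Relations F s.map :=
  s.2.choose_spec.choose_spec.choose_spec.1

variable (G F)

/-- The family of all maps that satisfy the relations, one for each seminorm. -/
def lamProd (a : G.A₀) : lp (fun s : G.RepNorm F => s.Alg) ∞ :=
  ⟨fun s => s.map a, by
    obtain ⟨K, hK⟩ := IsBdd.all (F := F) a
    refine memℓp_infty ⟨K, ?_⟩
    rintro _ ⟨s, rfl⟩
    exact hK s.Alg s.map s.relations⟩

/-- `E_F` inside the product of all C⋆-algebras generated by maps that satisfy the relations. -/
def EFsub : NonUnitalStarSubalgebra ℂ (lp (fun s : G.RepNorm F => s.Alg) ∞) :=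
  (NonUnitalStarAlgebra.adjoin ℂ (Set.range (G.lamProd F))).topologicalClosure

/-- The universal C⋆-algebra `E_F` generated by the elements `λ(a)`, `a ∈ A₀`, subject to the
relations: the completion of the `*`-algebra of polynomials in the generators in the supremum of
the seminorms of all maps that satisfy the relations. -/
def EF : Type u := G.EFsub F

instance : NonUnitalCStarAlgebra (G.EF F) :=
  NonUnitalStarSubalgebra.nonUnitalCStarAlgebra (G.EFsub F)
    (h_closed := NonUnitalStarSubalgebra.isClosed_topologicalClosure _)

/-- The universal map `λ : A₀ → E_F`. -/
def lam : G.A₀ →ₗ[ℂ] G.EF F where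
  toFun a := (⟨G.lamProd F a, NonUnitalStarSubalgebra.le_topologicalClosure _
    (NonUnitalStarAlgebra.subset_adjoin ℂ _ ⟨a, rfl⟩)⟩ : G.EFsub F)
  map_add' a b := by
    refine Subtype.ext (Subtype.ext ?_)
    funext s
    exact map_add s.map a b
  map_smul' r a := by
    refine Subtype.ext (Subtype.ext ?_)
    funext s
    exact map_smul s.map r a

/-- The `*`-algebra (not completed) generated by the elements `λ(a)`, `a ∈ A₀`. -/
def EF₀ : NonUnitalStarSubalgebra ℂ (G.EF F) :=
  NonUnitalStarAlgebra.adjoin ℂ (Set.range (G.lam F))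

/-! ### Coactions and the conditions A1, A2, A3 -/

/-- The multiplier algebra `M(C ⊗ A)`: the bounded families of matrices over `M(C)`. -/
abbrev MulTensor (C : Type u) [NonUnitalCStarAlgebra C] :
    StarSubalgebra ℂ (∀ β, Matrix (Fin (G.n β)) (Fin (G.n β)) 𝓜(ℂ, C)) :=
  BddFam (fun β => Fin (G.n β)) 𝓜(ℂ, C)

variable {G F} {C : Type u} [NonUnitalCStarAlgebra C]

/-- The family `X ∈ ∏_β M(C) ⊗ A_β` belongs to `C₀ ⊗_alg A₀`. -/
def InAlgTensor (C₀ : NonUnitalStarSubalgebra ℂ C)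
    (X : ∀ β, Matrix (Fin (G.n β)) (Fin (G.n β)) 𝓜(ℂ, C)) : Prop :=
  {β | X β ≠ 0}.Finite ∧ ∀ β k k', ∃ c ∈ C₀, X β k k' = DoubleCentralizer.coe ℂ c

/-- The component in `M(C) ⊗ A_β ⊗ A_γ` of `(id ⊗ Δ)(X)`, `X ∈ M(C ⊗ A)`, with matrix indices
`p`, `q`. The sum over `α` has finitely many nonzero terms, since the projections
`Δ(e_α)(e_β ⊗ e_γ)` are mutually orthogonal. -/
def idComp (X : G.MulTensor C) (β γ : I) (p q : Fin (G.n β) × Fin (G.n γ)) : 𝓜(ℂ, C) :=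
  ∑ᶠ α, ∑ i, ∑ i', G.com (AlgSum.unit α i i') β γ p q • X.1 α i i'

/-- Coassociativity of `δ : C → M(C ⊗ A)`: the elements `δ(c)(1 ⊗ e_γ)` are in `C ⊗ A_γ`, and
`(δ ⊗ id)δ = (id ⊗ Δ)δ`, componentwise. -/
def IsCoassociative (δ : C →⋆ₙₐ[ℂ] G.MulTensor C) : Prop :=
  ∀ (c : C) (γ : I) (k k' : Fin (G.n γ)), ∃ y : C,
    (δ c).1 γ k k' = DoubleCentralizer.coe ℂ y ∧
    ∀ (β : I) (j j' : Fin (G.n β)), (δ y).1 β j j' = idComp (δ c) β γ (j, k) (j', k')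

/-- Condition A1: `δ(c)(c' ⊗ 1) ∈ C₀ ⊗_alg A₀` for `c, c' ∈ C₀`. -/
def CondA1 (δ : C →⋆ₙₐ[ℂ] G.MulTensor C) (C₀ : NonUnitalStarSubalgebra ℂ C) : Prop :=
  ∀ c ∈ C₀, ∀ c' ∈ C₀, InAlgTensor C₀ fun β =>
    (δ c).1 β * Matrix.diagonal fun _ => DoubleCentralizer.coe ℂ c'

/-- Condition A2: `δ(c)(1 ⊗ a) ∈ C₀ ⊗_alg A₀` for `c ∈ C₀`, `a ∈ A₀`. -/
def CondA2 (δ : C →⋆ₙₐ[ℂ] G.MulTensor C) (C₀ : NonUnitalStarSubalgebra ℂ C) : Prop :=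
  ∀ c ∈ C₀, ∀ a : G.A₀, InAlgTensor C₀ fun β =>
    (δ c).1 β * (a.1 β).map (algebraMap ℂ 𝓜(ℂ, C))

/-- `(id ⊗ φ)(X(1 ⊗ e_β)) ∈ M(C)` for `X ∈ M(C ⊗ A)`. -/
def slice (φ : G.A₀ →ₗ[ℂ] ℂ) (X : G.MulTensor C) (β : I) : 𝓜(ℂ, C) :=
  ∑ k, ∑ k', φ (AlgSum.unit β k k') • X.1 β k k'

/-- `(id ⊗ φ)(X) = 1`: the net of the finite partial sums of the slices `(id ⊗ φ)(X(1 ⊗ e_β))`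
converges to `1` strictly in `M(C)`, that is, after multiplication by any element of `C` on the
right or on the left. -/
def SliceEqOne (φ : G.A₀ →ₗ[ℂ] ℂ) (X : G.MulTensor C) : Prop :=
  ∀ c : C, HasSum (fun β => (slice φ X β).fst c) c ∧ HasSum (fun β => (slice φ X β).snd c) c

/-- `h` is an element as in condition A3: `h ∈ C₀` is positive and `(id ⊗ φ)(δ(h²)) = 1`. -/
def IsA3Element (δ : C →⋆ₙₐ[ℂ] G.MulTensor C) (C₀ : NonUnitalStarSubalgebra ℂ C)
    (φ : G.A₀ →ₗ[ℂ] ℂ) (h : C) : Prop :=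
  h ∈ C₀ ∧ (∃ z : C, h = star z * z) ∧ SliceEqOne φ (δ (h * h))

variable (G F) in
/-- `δ` is the `*`-homomorphism `Δ_F : E_F → M(E_F ⊗ A)` with `Δ_F(λ(a)) = (λ ⊗ id)(Δ(a))`. -/
def IsDeltaF (δ : G.EF F →⋆ₙₐ[ℂ] G.MulTensor (G.EF F)) : Prop :=
  ∀ (a : G.A₀) (β : I) (k k' : Fin (G.n β)),
    (δ (G.lam F a)).1 β k k' = DoubleCentralizer.coe ℂ (G.tilde (G.lam F) β a k k')

end Comultiplication

end

noncomputable section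

namespace Comultiplication

/-! ### Algebraic consequences of the axioms -/

section Algebra

variable {I : Type u} {G : Comultiplication I}

/-! Everything rests on local units. Since `T₁` is onto, each block of `Δ(x)` depends on finitely
many components of `x`. As `F` is finite, every `b` has a finite set `orthSupp F b` with the
following property: `λ(x)λ(b)` is `0` if `x` is `0` on that set, by (ii), and is `λ(b)` if `x` is
`1` on it, by (ii) and (iii). So the `λ(e_K)` are local units, and (iii) becomes an algebraic
identity (`vanishes_sum_iff`).

For each `β` the map `a ↦ (λ ⊗ id)(Δ(a)(1 ⊗ e_β))` into `M_{n β}(E_F)` satisfies the relations again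
(`Relations.tildeC`): (i) because `Δ` is a `*`-homomorphism, (ii) because it is imposed for all `n`,
(iii) by the local units. The universal property (`Relations.exists_lift`) turns it into a
`*`-homomorphism `psi β`; these are contractions, so together they form a bounded family, which is
`Δ_F`. Uniqueness and coassociativity are checked on the generators and extend by multiplicativity
and continuity.

A1 holds because for fixed `J`, `J'` and almost all `β` the legs of `Δ(e_J)` at `β` are orthogonal
to `e_{J'}` in the sense of (ii) (`finite_not_fOrth`). For A3, left invariance makes the slices of
`Δ(h₀)` add up to `1` on any finite set of blocks, so the partial sums of their images in `E_F`
eventually act as a unit on each generator. These partial sums are positive, since `φ` has a Gram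
matrix on every block, and a comparison with a larger partial sum bounds them by `1`; density then
gives strict convergence. The square root of `λ(h₀)` is a limit of polynomials, so `C₀` is taken to
be the algebra `localAlg` of all elements with a local unit, which contains it. -/

theorem coe_sum_apply {ι : Type*} (s : Finset ι) (f : ι → G.A₀) (γ : I) :
    (∑ x ∈ s, f x).1 γ = ∑ x ∈ s, (f x).1 γ := by
  rw [AddSubmonoidClass.coe_finsetSum, Finset.sum_apply]

theorem single_apply_self (α : I) (x : Matrix (Fin (G.n α)) (Fin (G.n α)) ℂ) :
    (AlgSum.single α x : G.A₀).1 α = x := by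
  simp [AlgSum.single]

open Classical in
theorem single_apply_of_ne {α β : I} (h : β ≠ α) (x : Matrix (Fin (G.n α)) (Fin (G.n α)) ℂ) :
    (AlgSum.single α x : G.A₀).1 β = 0 :=
  Pi.single_eq_of_ne (M := fun α => Matrix (Fin (G.n α)) (Fin (G.n α)) ℂ) h x

/-- The identity `e_J` of a finite set of blocks. -/
def eFin (G : Comultiplication I) (J : Finset I) : G.A₀ := ∑ α ∈ J, AlgSum.e α

theorem eFin_apply_of_mem {J : Finset I} {β : I} (h : β ∈ J) : (G.eFin J).1 β = 1 := by
  rw [eFin, coe_sum_apply, Finset.sum_eq_single β]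
  · exact single_apply_self β 1
  · intro α _ hα
    exact single_apply_of_ne (Ne.symm hα) 1
  · exact fun hc => absurd h hc

theorem e_apply_of_ne {α β : I} (h : β ≠ α) : (AlgSum.e α : G.A₀).1 β = 0 :=
  single_apply_of_ne h 1

theorem com_mul (a b : G.A₀) (α β : I) : G.com (a * b) α β = G.com a α β * G.com b α β := by
  have h : AlgSum.toM (a * b) = AlgSum.toM a * AlgSum.toM b := rfl
  simp only [com, h, map_mul]
  rfl

theorem com_star (a : G.A₀) (α β : I) : G.com (star a) α β = (G.com a α β).conjTranspose := by
  have h : AlgSum.toM (star a) = star (AlgSum.toM a) := rfl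
  simp only [com, h, map_star]
  rfl

/-- The component of `Δ` in a block, as a linear map. -/
def comLin (G : Comultiplication I) (α β : I) : G.A₀ →ₗ[ℂ]
    Matrix (Fin (G.n α) × Fin (G.n β)) (Fin (G.n α) × Fin (G.n β)) ℂ where
  toFun a := G.com a α β
  map_add' a b := com_add G a b α β
  map_smul' r a := com_smul G r a α β

theorem com_zero (α β : I) : G.com 0 α β = 0 := map_zero (G.comLin α β)

theorem com_sum {ι : Type*} (s : Finset ι) (f : ι → G.A₀) (α β : I) :
    G.com (∑ x ∈ s, f x) α β = ∑ x ∈ s, G.com (f x) α β :=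
  map_sum (G.comLin α β) f s

theorem leg₁_apply (γ : I) (k k' : Fin (G.n γ)) (b : G.A₀) (α : I) (i i' : Fin (G.n α)) :
    (G.leg₁ γ k k' b).1 α i i' = G.com b α γ (i, k) (i', k') := rfl

theorem leg₂_apply (α : I) (i i' : Fin (G.n α)) (b : G.A₀) (γ : I) (k k' : Fin (G.n γ)) :
    (G.leg₂ α i i' b).1 γ k k' = G.com b α γ (i, k) (i', k') := rfl

theorem mul_apply (a b : G.A₀) (α : I) : (a * b).1 α = a.1 α * b.1 α := rfl

theorem star_apply (a : G.A₀) (α : I) : (star a).1 α = (a.1 α).conjTranspose := rfl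

theorem ext_entry {a b : G.A₀} (h : ∀ α i i', a.1 α i i' = b.1 α i i') : a = b :=
  Subtype.ext (funext fun α => by ext i i'; exact h α i i')

theorem leg₁_star (γ : I) (k k' : Fin (G.n γ)) (a : G.A₀) :
    G.leg₁ γ k k' (star a) = star (G.leg₁ γ k' k a) := by
  refine ext_entry fun α i i' => ?_
  rw [leg₁_apply, com_star, star_apply, Matrix.conjTranspose_apply, Matrix.conjTranspose_apply,
    leg₁_apply]

theorem leg₁_mul (γ : I) (k k' : Fin (G.n γ)) (a b : G.A₀) :
    G.leg₁ γ k k' (a * b) = ∑ l, G.leg₁ γ k l a * G.leg₁ γ l k' b := by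
  refine ext_entry fun α i i' => ?_
  rw [leg₁_apply, com_mul, Matrix.mul_apply, Fintype.sum_prod_type, coe_sum_apply,
    Matrix.sum_apply, Finset.sum_comm]
  refine Finset.sum_congr rfl fun l _ => ?_
  rw [mul_apply, Matrix.mul_apply]
  rfl

/-- An element that vanishes on the support of `x` vanishes after multiplication with `x`. -/
theorem mul_eq_zero_of_eqOn {S : Finset I} {x a : G.A₀} (ha : ∀ α, a.1 α ≠ 0 → α ∈ S)
    (hx : ∀ α ∈ S, x.1 α = 0) : x * a = 0 := by
  refine Subtype.ext (funext fun α => ?_)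
  rw [mul_apply]
  by_cases h : a.1 α = 0
  · rw [h, mul_zero]; rfl
  · rw [hx α (ha α h), zero_mul]; rfl

theorem mul_eq_self_of_eqOn {S : Finset I} {x a : G.A₀} (ha : ∀ α, a.1 α ≠ 0 → α ∈ S)
    (hx : ∀ α ∈ S, x.1 α = 1) : x * a = a := by
  refine Subtype.ext (funext fun α => ?_)
  rw [mul_apply]
  by_cases h : a.1 α = 0
  · rw [h, mul_zero]
  · rw [hx α (ha α h), one_mul]

/-- The support of an element of `A₀`. -/
def supp (a : G.A₀) : Finset I :=
  Set.Finite.toFinset (s := {α | a.1 α ≠ 0}) a.2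

theorem mem_supp {a : G.A₀} {α : I} : α ∈ supp a ↔ a.1 α ≠ 0 :=
  Set.Finite.mem_toFinset (s := {α | a.1 α ≠ 0}) a.2

/-! ### Finite dependence of the blocks of `Δ(x)` on `x` -/

open scoped TensorProduct in
-- For `t = a ⊗ b` one has `Δ(x)Δ(a)(1 ⊗ b) = Δ(xa)(1 ⊗ b)`, and `xa` only sees `x` on the support
-- of `a`.
theorem exists_com_mul_T₁ (t : G.A₀ ⊗[ℂ] G.A₀) (γ β : I) : ∃ J : Finset I, ∀ x : G.A₀,
    ((∀ α ∈ J, x.1 α = 0) → G.com x γ β * G.T₁ t (γ, β) = 0) ∧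
    ((∀ α ∈ J, x.1 α = 1) → G.com x γ β * G.T₁ t (γ, β) = G.T₁ t (γ, β)) := by
  classical
  induction t using TensorProduct.induction_on with
  | zero => exact ⟨∅, fun x => by simp⟩
  | tmul a b =>
    refine ⟨supp a, fun x => ?_⟩
    have h : G.T₁ (a ⊗ₜ b) (γ, β) = G.com a γ β *
        Matrix.kronecker (1 : Matrix (Fin (G.n γ)) (Fin (G.n γ)) ℂ) (b.1 β) := rfl
    rw [h, ← mul_assoc, ← com_mul]
    constructor
    · intro hx
      rw [mul_eq_zero_of_eqOn (fun α => mem_supp.2) hx, com_zero, zero_mul]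
    · intro hx
      rw [mul_eq_self_of_eqOn (fun α => mem_supp.2) hx]
  | add s t hs ht =>
    obtain ⟨J, hJ⟩ := hs
    obtain ⟨K, hK⟩ := ht
    refine ⟨J ∪ K, fun x => ⟨fun hx => ?_, fun hx => ?_⟩⟩
    · rw [map_add, Pi.add_apply, mul_add, (hJ x).1 fun α h => hx α (Finset.mem_union_left _ h),
        (hK x).1 fun α h => hx α (Finset.mem_union_right _ h), add_zero]
    · rw [map_add, Pi.add_apply, mul_add, (hJ x).2 fun α h => hx α (Finset.mem_union_left _ h),
        (hK x).2 fun α h => hx α (Finset.mem_union_right _ h)]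

/-- In a given block, `Δ(x)` depends on finitely many components of `x` only, and it is the
identity if these are. -/
theorem IsDiscreteQuantumGroup.exists_com (hG : G.IsDiscreteQuantumGroup) (γ β : I) :
    ∃ J : Finset I, ∀ x : G.A₀, ((∀ α ∈ J, x.1 α = 0) → G.com x γ β = 0) ∧
      ((∀ α ∈ J, x.1 α = 1) → G.com x γ β = 1) := by
  classical
  -- The identity of the block lies in `A₀ ⊗ A₀`, hence in the range of `T₁`; multiplying by it
  -- isolates `Δ(x)` in this block.
  have hY : (Pi.single (γ, β) 1 : G.MAlg₂) ∈ G.finSupp₂ := by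
    refine (Set.finite_singleton (γ, β)).subset fun p hp => ?_
    by_contra hc
    exact hp (Pi.single_eq_of_ne hc _)
  rw [← hG.T₁_range] at hY
  obtain ⟨t, ht⟩ := hY
  obtain ⟨J, hJ⟩ := exists_com_mul_T₁ t γ β
  rw [ht, Pi.single_eq_same] at hJ
  simp only [mul_one] at hJ
  exact ⟨J, hJ⟩

/-- A finite set of blocks that determines the component of `Δ` in the block `(γ, β)`. -/
def IsDiscreteQuantumGroup.comSupp (hG : G.IsDiscreteQuantumGroup) (γ β : I) : Finset I :=
  (hG.exists_com γ β).choose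

theorem IsDiscreteQuantumGroup.com_eq_zero (hG : G.IsDiscreteQuantumGroup) {γ β : I} {x : G.A₀}
    (hx : ∀ α ∈ hG.comSupp γ β, x.1 α = 0) : G.com x γ β = 0 :=
  ((hG.exists_com γ β).choose_spec x).1 hx

theorem IsDiscreteQuantumGroup.com_eq_one (hG : G.IsDiscreteQuantumGroup) {γ β : I} {x : G.A₀}
    (hx : ∀ α ∈ hG.comSupp γ β, x.1 α = 1) : G.com x γ β = 1 :=
  ((hG.exists_com γ β).choose_spec x).2 hx

theorem eq_sum_unit (x : G.A₀) {J : Finset I} (hJ : ∀ α, x.1 α ≠ 0 → α ∈ J) :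
    x = ∑ α ∈ J, ∑ i, ∑ i', x.1 α i i' • (AlgSum.unit α i i' : G.A₀) := by
  refine Subtype.ext (funext fun δ => ?_)
  have hcoe : ∀ α, (∑ i, ∑ i', x.1 α i i' • (AlgSum.unit α i i' : G.A₀)).1 δ
      = ∑ i, ∑ i', x.1 α i i' • (AlgSum.unit α i i' : G.A₀).1 δ := by
    intro α
    simp only [coe_sum_apply]
    rfl
  rw [coe_sum_apply]
  simp only [hcoe]
  by_cases hδ : x.1 δ = 0
  · rw [hδ, Finset.sum_eq_zero]
    intro α _
    refine Finset.sum_eq_zero fun i _ => Finset.sum_eq_zero fun j _ => ?_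
    by_cases h : δ = α
    · subst h
      rw [hδ, Matrix.zero_apply, zero_smul]
    · rw [AlgSum.unit, single_apply_of_ne h, smul_zero]
  · rw [Finset.sum_eq_single δ]
    · conv_lhs => rw [Matrix.matrix_eq_sum_single (x.1 δ)]
      refine Finset.sum_congr rfl fun i _ => Finset.sum_congr rfl fun j _ => ?_
      rw [AlgSum.unit, single_apply_self, Matrix.smul_single, smul_eq_mul, mul_one]
    · intro α _ hα
      refine Finset.sum_eq_zero fun i _ => Finset.sum_eq_zero fun j _ => ?_
      rw [AlgSum.unit, single_apply_of_ne (Ne.symm hα), smul_zero]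
    · exact fun hc => absurd (hJ δ hδ) hc

/-- The index set is independent of `x`, which is what lets coassociativity be written as a finite
sum that is uniform in the argument. -/
theorem IsDiscreteQuantumGroup.com_eq_sum (hG : G.IsDiscreteQuantumGroup) (γ β : I) (x : G.A₀) :
    G.com x γ β = ∑ α ∈ hG.comSupp γ β, ∑ i, ∑ i', x.1 α i i' • G.com (AlgSum.unit α i i') γ β := by
  classical
  conv_lhs => rw [eq_sum_unit x (J := hG.comSupp γ β ∪ supp x) fun α hα =>
    Finset.mem_union_right _ (mem_supp.2 hα)]
  simp only [com_sum, com_smul]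
  refine (Finset.sum_subset Finset.subset_union_left fun α _ hα => ?_).symm
  refine Finset.sum_eq_zero fun i _ => Finset.sum_eq_zero fun i' _ => ?_
  rw [hG.com_eq_zero, smul_zero]
  intro δ hδ
  refine single_apply_of_ne ?_ _
  rintro rfl
  exact hα hδ

/-- `(Δ ⊗ id)Δ = (id ⊗ Δ)Δ`, in terms of matrix units. -/
theorem IsDiscreteQuantumGroup.leg₁_leg₁ (hG : G.IsDiscreteQuantumGroup) (a : G.A₀) (β γ : I)
    (j j' : Fin (G.n β)) (k k' : Fin (G.n γ)) :
    G.leg₁ β j j' (G.leg₁ γ k k' a) = ∑ α ∈ hG.comSupp β γ, ∑ i, ∑ i',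
      G.com (AlgSum.unit α i i') β γ (j, k) (j', k') • G.leg₁ α i i' a := by
  refine ext_entry fun δ l l' => ?_
  rw [leg₁_apply, hG.coassoc, hG.com_eq_sum]
  simp only [coe_sum_apply, Matrix.sum_apply]
  refine Finset.sum_congr rfl fun α _ => Finset.sum_congr rfl fun i _ =>
    Finset.sum_congr rfl fun i' _ => ?_
  rw [Matrix.smul_apply, leg₂_apply, smul_eq_mul, mul_comm]
  rfl

/-- A finite set such that elements that vanish on it are orthogonal to `b`. -/
def IsDiscreteQuantumGroup.orthSupp (hG : G.IsDiscreteQuantumGroup) (F : Finset I) (b : G.A₀) :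
    Finset I :=
  open Classical in F.biUnion fun β => (supp b).biUnion fun γ => hG.comSupp β γ

/-- Only the blocks `(β, γ)` with `β ∈ F` and `γ` in the support of `b` matter, and there `Δ(x)`
vanishes. -/
theorem IsDiscreteQuantumGroup.fOrth (hG : G.IsDiscreteQuantumGroup) {F : Finset I} {x b : G.A₀}
    (hx : ∀ α ∈ hG.orthSupp F b, x.1 α = 0) : G.FOrth F x b := by
  intro β hβ γ
  change G.com x β γ * Matrix.kronecker (1 : Matrix (Fin (G.n β)) (Fin (G.n β)) ℂ) (b.1 γ) = 0
  by_cases hγ : b.1 γ = 0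
  · rw [hγ, Matrix.kronecker, Matrix.kroneckerMap_zero_right _ (fun _ => mul_zero _), mul_zero]
  · rw [hG.com_eq_zero, zero_mul]
    intro α hα
    refine hx α ?_
    simp only [orthSupp, Finset.mem_biUnion]
    exact ⟨β, hβ, γ, mem_supp.2 hγ, hα⟩

/-- For all but finitely many `β`, the elements `leg₁ β k k' a` are orthogonal to `b`. -/
theorem IsDiscreteQuantumGroup.finite_not_fOrth (hG : G.IsDiscreteQuantumGroup) (F : Finset I)
    (a b : G.A₀) : ∃ S : Finset I, ∀ β ∉ S, ∀ k k', G.FOrth F (G.leg₁ β k k' a) b := by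
  classical
  -- By coassociativity the block `(μ, ν)` of `Δ` of a right leg at `β` is read off from the block
  -- `(ν, β)` of `Δ` of a left leg at `μ`; for fixed `ν`, finiteness of `(e_ν ⊗ 1)Δ(·)` leaves
  -- finitely many `β`.
  have hfin : ∀ (μ ν : I) (i i' : Fin (G.n μ)), ∃ S : Finset I, ∀ β ∉ S,
      G.com (G.leg₂ μ i i' a) ν β = 0 := by
    intro μ ν i i'
    refine ⟨((G.finite_T₂ (AlgSum.e ν) (G.leg₂ μ i i' a)).image Prod.snd).toFinset,
      fun β hβ => ?_⟩
    by_contra hc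
    refine hβ ((Set.Finite.mem_toFinset _).2 ⟨(ν, β), ?_, rfl⟩)
    have he : (AlgSum.e ν : G.A₀).1 ν = 1 := single_apply_self ν 1
    intro h0
    have h1 : Matrix.kronecker ((AlgSum.e ν : G.A₀).1 ν)
        (1 : Matrix (Fin (G.n β)) (Fin (G.n β)) ℂ) * G.com (G.leg₂ μ i i' a) ν β = 0 := h0
    rw [he] at h1
    apply hc
    simpa [Matrix.kronecker] using h1
  choose S hS using hfin
  refine ⟨F.biUnion fun μ => (supp b).biUnion fun ν => Finset.univ.biUnion fun i =>
    Finset.univ.biUnion fun i' => S μ ν i i', fun β hβ k k' μ hμ ν => ?_⟩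
  change G.com (G.leg₁ β k k' a) μ ν *
    Matrix.kronecker (1 : Matrix (Fin (G.n μ)) (Fin (G.n μ)) ℂ) (b.1 ν) = 0
  by_cases hν : b.1 ν = 0
  · rw [hν, Matrix.kronecker, Matrix.kroneckerMap_zero_right _ (fun _ => mul_zero _), mul_zero]
  · have h0 : G.com (G.leg₁ β k k' a) μ ν = 0 := by
      ext ⟨i, j⟩ ⟨i', j'⟩
      rw [hG.coassoc, hS]
      · rfl
      · intro hc
        apply hβ
        simp only [Finset.mem_biUnion, Finset.mem_univ, true_and]
        exact ⟨μ, hμ, ν, mem_supp.2 hν, i, i', hc⟩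
    rw [h0, zero_mul]

/-! ### Calculus of matrix units -/

theorem single_mul_single (α : I) (x y : Matrix (Fin (G.n α)) (Fin (G.n α)) ℂ) :
    (AlgSum.single α x : G.A₀) * AlgSum.single α y = AlgSum.single α (x * y) := by
  refine Subtype.ext (funext fun β => ?_)
  rw [mul_apply]
  by_cases h : β = α
  · subst h; simp only [single_apply_self]
  · simp only [single_apply_of_ne h, mul_zero]

theorem single_mul_single_of_ne {α β : I} (h : α ≠ β) (x : Matrix (Fin (G.n α)) (Fin (G.n α)) ℂ)
    (y : Matrix (Fin (G.n β)) (Fin (G.n β)) ℂ) :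
    (AlgSum.single α x : G.A₀) * AlgSum.single β y = 0 := by
  refine Subtype.ext (funext fun γ => ?_)
  rw [mul_apply]
  by_cases hγ : γ = α
  · subst hγ; rw [single_apply_of_ne h, mul_zero]; rfl
  · rw [single_apply_of_ne hγ, zero_mul]; rfl

theorem unit_mul_unit (α : I) (i j k l : Fin (G.n α)) :
    (AlgSum.unit α i j : G.A₀) * AlgSum.unit α k l = if j = k then AlgSum.unit α i l else 0 := by
  rw [AlgSum.unit, AlgSum.unit, single_mul_single]
  split_ifs with h
  · subst h
    rw [Matrix.single_mul_single_same, mul_one]; rfl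
  · rw [Matrix.single_mul_single_of_ne _ _ _ _ h]
    refine Subtype.ext (funext fun γ => ?_)
    by_cases hγ : γ = α
    · subst hγ; rw [single_apply_self]; rfl
    · rw [single_apply_of_ne hγ]; rfl

theorem star_unit (α : I) (i j : Fin (G.n α)) :
    star (AlgSum.unit α i j : G.A₀) = AlgSum.unit α j i := by
  refine Subtype.ext (funext fun γ => ?_)
  rw [star_apply]
  by_cases hγ : γ = α
  · subst hγ; simp [AlgSum.unit, single_apply_self]
  · simp [AlgSum.unit, single_apply_of_ne hγ]

end Algebra

end Comultiplication

/-! ### Positivity in C⋆-algebras -/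

section Positivity

variable {B : Type*} [NonUnitalCStarAlgebra B]

theorem eq_zero_of_isSelfAdjoint_of_cube {n : B} (hn : IsSelfAdjoint n) (h : n * n * n = 0) :
    n = 0 := by
  have h1 : (n * n) * (n * n) = 0 := by rw [← mul_assoc, h, zero_mul]
  have h2 : n * n = 0 := by
    have hs : star (n * n) = n * n := by rw [star_mul, hn.star_eq]
    have := CStarRing.star_mul_self_eq_zero_iff (n * n)
    rw [hs] at this
    exact this.1 h1
  have := CStarRing.star_mul_self_eq_zero_iff n
  rw [hn.star_eq] at this
  exact this.1 h2

/-- Positivity is detected by jointly injective `*`-homomorphisms. -/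
theorem exists_eq_star_mul_self_of_forall {ι : Type*} {C : ι → Type*}
    [∀ i, NonUnitalCStarAlgebra (C i)] (f : ∀ i, B →⋆ₙₐ[ℂ] C i)
    (hf : ∀ x, (∀ i, f i x = 0) → x = 0) (x : B) (h : ∀ i, ∃ z, f i x = star z * z) :
    ∃ z, x = star z * z := by
  let _ := CStarAlgebra.spectralOrder B
  have := CStarAlgebra.spectralOrderedRing B
  have hx : IsSelfAdjoint x := by
    rw [IsSelfAdjoint, ← sub_eq_zero]
    refine hf _ fun i => ?_
    obtain ⟨z, hz⟩ := h i
    rw [map_sub, map_star, hz, star_mul, star_star, sub_self]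
  rw [← CStarAlgebra.nonneg_iff_eq_star_mul_self,
    CStarAlgebra.nonneg_iff_isSelfAdjoint_and_negPart_eq_zero]
  refine ⟨hx, ?_⟩
  have hneg : 0 ≤ x⁻ := CFC.negPart_nonneg x
  refine eq_zero_of_isSelfAdjoint_of_cube hneg.isSelfAdjoint (hf _ fun i => ?_)
  -- The image of `(x⁻)³ = -x⁻ x x⁻` is `≤ 0` because that of `x` is positive, and `≥ 0` because
  -- that of `x⁻` is. Only this identity is transported along `f i`, not the functional calculus.
  have hcube : x⁻ * x⁻ * x⁻ = - (star x⁻ * x * x⁻) := by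
    have h1 : x⁻ * x = - (x⁻ * x⁻) := by
      have h2 : x⁻ * x = x⁻ * (x⁺ - x⁻) := by rw [CFC.posPart_sub_negPart x hx]
      rw [h2, mul_sub, CFC.negPart_mul_posPart, zero_sub]
    rw [hneg.isSelfAdjoint.star_eq, h1, neg_mul, neg_neg]
  let _ := CStarAlgebra.spectralOrder (C i)
  have := CStarAlgebra.spectralOrderedRing (C i)
  apply le_antisymm
  · rw [hcube, map_neg, map_mul, map_mul, map_star]
    obtain ⟨z, hz⟩ := h i
    have : 0 ≤ f i x := hz ▸ star_mul_self_nonneg z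
    exact neg_nonpos.2 (star_left_conjugate_nonneg this _)
  · obtain ⟨w, hw⟩ := CStarAlgebra.nonneg_iff_eq_star_mul_self.1 hneg
    have : 0 ≤ f i x⁻ := by
      rw [hw, map_mul, map_star]
      exact star_mul_self_nonneg _
    rw [map_mul, map_mul]
    exact conjugate_nonneg_of_nonneg this this

/-- A positive element that has a local unit above it is a contraction. -/
theorem norm_le_one_of_mul_eq_self {p q z w : B} (hp : p = star z * z) (hq : q - p = star w * w)
    (h : q * p = p) : ‖p‖ ≤ 1 := by
  let _ := CStarAlgebra.spectralOrder B
  have := CStarAlgebra.spectralOrderedRing B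
  have hp0 : 0 ≤ p := hp ▸ star_mul_self_nonneg z
  have hpq : p ≤ q := sub_nonneg.1 (hq ▸ star_mul_self_nonneg w)
  have hsa := hp0.isSelfAdjoint
  -- Conjugate `p ≤ q` by `p` and use `qp = p`. With the C⋆-identity this gives `‖p‖⁴ = ‖p⁴‖ ≤
  -- ‖p³‖‖p‖ ≤ ‖p‖³`.
  have hle : p * p * p ≤ p * p := by
    have h1 := hsa.conjugate_le_conjugate hpq
    rwa [mul_assoc p q p, h] at h1
  have hnn : 0 ≤ p * p * p := conjugate_nonneg_of_nonneg hp0 hp0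
  have h1 : ‖p * p * p‖ ≤ ‖p * p‖ := CStarAlgebra.norm_le_norm_of_nonneg_of_le hnn hle
  have h2 : ‖p * p‖ = ‖p‖ * ‖p‖ := by
    have := CStarRing.norm_star_mul_self (x := p)
    rwa [hsa.star_eq] at this
  have h3 : ‖(p * p) * (p * p)‖ = ‖p * p‖ * ‖p * p‖ := by
    have := CStarRing.norm_star_mul_self (x := p * p)
    rwa [star_mul, hsa.star_eq] at this
  have h4 : ‖(p * p) * (p * p)‖ ≤ ‖p * p * p‖ * ‖p‖ := by
    rw [← mul_assoc]
    exact norm_mul_le _ _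
  by_contra hc
  push Not at hc
  have h5 : ‖p * p * p‖ * ‖p‖ ≤ (‖p‖ * ‖p‖) * ‖p‖ := by
    rw [← h2]
    exact mul_le_mul_of_nonneg_right h1 (norm_nonneg p)
  rw [h3, h2] at h4
  have h6 : 0 < ‖p‖ * (‖p‖ * ‖p‖) := by positivity
  nlinarith

end Positivity

namespace Comultiplication

variable {I : Type u} {G : Comultiplication I}

/-! ### The relations under homomorphisms -/

section Vanishing

/-- A homomorphism of algebras, applied to the entries of matrices. -/
def matMap {B C : Type*} [NonUnitalRing B] [Module ℂ B] [NonUnitalRing C] [Module ℂ C]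
    (k : Type*) [Fintype k] (f : B →ₙₐ[ℂ] C) : Matrix k k B →ₙₐ[ℂ] Matrix k k C where
  toFun X := X.map f
  map_smul' r X := by ext; simp
  map_zero' := by ext; simp
  map_add' X Y := by ext; simp
  map_mul' X Y := by ext; simp [Matrix.mul_apply, map_sum]

theorem map_foldl_mul {B C : Type*} [NonUnitalRing B] [NonUnitalRing C] [Module ℂ B] [Module ℂ C]
    (f : B →ₙₐ[ℂ] C) (l : G.A₀ → B) (xs : List G.A₀) (a : B) :
    f (xs.foldl (fun z x => z * l x) a) = xs.foldl (fun z x => z * f (l x)) (f a) := by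
  induction xs generalizing a with
  | nil => rfl
  | cons x xs ih => rw [List.foldl_cons, List.foldl_cons, ih, map_mul]

/-- The relation says that certain products are zero, which a jointly injective family detects. Each
step in `n` replaces the algebras by matrix algebras, where the entrywise maps are still jointly
injective. -/
theorem Vanishes.of_forall {F : Finset I} (n : ℕ) {B : Type u} [NonUnitalRing B] [Module ℂ B]
    {ι : Type*} {C : ι → Type u} [∀ i, NonUnitalRing (C i)] [∀ i, Module ℂ (C i)]
    (f : ∀ i, B →ₙₐ[ℂ] C i) (hf : ∀ x, (∀ i, f i x = 0) → x = 0) (l : G.A₀ →ₗ[ℂ] B)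
    (h : ∀ i, G.Vanishes F n ((f i : B →ₗ[ℂ] C i) ∘ₗ l)) : G.Vanishes F n l := by
  induction n generalizing B C with
  | zero =>
    intro a b hab xs
    refine hf _ fun i => ?_
    rw [map_mul, map_foldl_mul]
    exact h i a b hab xs
  | succ n ih =>
    intro β
    refine ih (fun i => matMap (Fin (G.n β)) (f i)) (fun X hX => ?_) _ fun i => h i β
    ext k k'
    exact hf _ fun i => congrFun (congrFun (hX i) k) k'

end Vanishing

section Relations

variable {F : Finset I} {B : Type u} [NonUnitalCStarAlgebra B] {l : G.A₀ →ₗ[ℂ] B}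

/-- The image of `Y* Y` for `Y` with rows `(x, y)` and `(0, 0)` is Hermitian, and its off-diagonal
entries give `l(y* x) = l(x* y)*`. Then `x` is taken to be a unit for `y = a`. -/
theorem Relations.map_star (h : G.Relations F l) (a : G.A₀) : l (star a) = star (l a) := by
  have key : ∀ x y : G.A₀, l (star y * x) = star (l (star x * y)) := by
    intro x y
    obtain ⟨Z, hZ⟩ := h.cp 2 !![x, y; 0, 0]
    have hH : (Z.conjTranspose * Z).IsHermitian := Matrix.isHermitian_conjTranspose_mul_self Z
    rw [← hZ] at hH
    have h10 := hH.apply 1 0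
    simpa [Matrix.mul_apply, Matrix.map_apply, Fin.sum_univ_two] using h10.symm
  have hS : G.eFin (supp a) * a = a :=
    mul_eq_self_of_eqOn (fun α => mem_supp.2) fun α hα => eFin_apply_of_mem hα
  have hstar : star (G.eFin (supp a)) = G.eFin (supp a) := by
    rw [eFin, star_sum]
    refine Finset.sum_congr rfl fun α _ => ?_
    rw [← e_star_mul α, star_mul, star_star]
  have := key (G.eFin (supp a)) a
  rw [hstar, hS] at this
  rw [← this]
  congr 1
  conv_lhs => rw [← hS, star_mul, hstar]

theorem Relations.mul_eq_zero (h : G.Relations F l) (hG : G.IsDiscreteQuantumGroup) {x b : G.A₀}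
    (hx : ∀ α ∈ hG.orthSupp F b, x.1 α = 0) : l x * l b = 0 :=
  h.vanish 0 x b (hG.fOrth hx) []

/-- By (ii) all terms outside a finite set vanish, so the convergence in (iii) is a single algebraic
identity. In this form (iii) can be verified coordinatewise in a product and entrywise in matrices.
-/
theorem vanishes_sum_iff (hG : G.IsDiscreteQuantumGroup) (h0 : G.Vanishes F 0 l) (b : G.A₀) :
    HasSum (fun α => l (AlgSum.e α) * l b) (l b) ↔
      l (G.eFin (hG.orthSupp F b)) * l b = l b := by
  have hs : HasSum (fun α => l (AlgSum.e α) * l b)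
      (∑ α ∈ hG.orthSupp F b, l (AlgSum.e α) * l b) := by
    refine hasSum_sum_of_ne_finset_zero fun α hα => ?_
    refine h0 (AlgSum.e α) b (hG.fOrth fun β hβ => e_apply_of_ne ?_) []
    rintro rfl
    exact hα hβ
  rw [← Finset.sum_mul, ← map_sum] at hs
  change HasSum _ (l (G.eFin (hG.orthSupp F b)) * l b) at hs
  exact ⟨fun h => hs.unique h, fun h => by rwa [h] at hs⟩

theorem Relations.mul_eq_self (h : G.Relations F l) (hG : G.IsDiscreteQuantumGroup) {x b : G.A₀}
    (hx : ∀ α ∈ hG.orthSupp F b, x.1 α = 1) : l x * l b = l b := by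
  have h1 := (vanishes_sum_iff hG (h.vanish 0) b).1 (h.sum b)
  have h2 : l (x - G.eFin (hG.orthSupp F b)) * l b = 0 := by
    refine h.mul_eq_zero hG fun α hα => ?_
    change x.1 α - (G.eFin _).1 α = 0
    rw [hx α hα, eFin_apply_of_mem hα, sub_self]
  rw [map_sub, sub_mul, sub_eq_zero] at h2
  rw [h2, h1]

theorem tilde_mul_apply (x b : G.A₀) (β : I) (k k' : Fin (G.n β)) :
    (G.tilde l β x * G.tilde l β b) k k' = ∑ m, l (G.leg₁ β k m x) * l (G.leg₁ β m k' b) := rfl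

/-- If `x` is `1` on enough blocks, then `Δ(x)` is `1` on all blocks seen by the entries of the
second factor. There the legs of `x` are `1` on the diagonal and `0` off it, so the first factor
acts like an identity matrix. -/
theorem Relations.tilde_mul_eq_self (h : G.Relations F l) (hG : G.IsDiscreteQuantumGroup)
    (β : I) (b : G.A₀) : ∃ J : Finset I, ∀ x : G.A₀, (∀ α ∈ J, x.1 α = 1) →
      G.tilde l β x * G.tilde l β b = G.tilde l β b := by
  classical
  refine ⟨Finset.univ.biUnion fun k => Finset.univ.biUnion fun k' =>
    (hG.orthSupp F (G.leg₁ β k k' b)).biUnion fun γ => hG.comSupp γ β, fun x hx => ?_⟩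
  have hcom : ∀ k k', ∀ γ ∈ hG.orthSupp F (G.leg₁ β k k' b), G.com x γ β = 1 := by
    intro k k' γ hγ
    refine hG.com_eq_one fun α hα => hx α ?_
    simp only [Finset.mem_biUnion, Finset.mem_univ, true_and]
    exact ⟨k, k', γ, hγ, hα⟩
  ext k k'
  rw [tilde_mul_apply, Finset.sum_eq_single k]
  · refine h.mul_eq_self hG fun γ hγ => ?_
    ext i i'
    rw [leg₁_apply, hcom k k' γ hγ]
    simp [Matrix.one_apply]
  · intro m _ hm
    refine h.mul_eq_zero hG fun γ hγ => ?_
    ext i i'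
    rw [leg₁_apply, hcom m k' γ hγ]
    simp [hm.symm]
  · exact fun hc => absurd (Finset.mem_univ k) hc

end Relations

end Comultiplication

namespace Comultiplication

variable {I : Type u} {G : Comultiplication I}

attribute [local instance] CStarAlgebra.spectralOrder CStarAlgebra.spectralOrderedRing

/-! ### The relations for `(l ⊗ id) ∘ Δ` -/

section Tilde

variable {F : Finset I} {B : Type u} [NonUnitalCStarAlgebra B]

/-- The map `a ↦ (l ⊗ id)(Δ(a)(1 ⊗ e_β))` into the C⋆-algebra `M_{n β}(B)`. -/
def tildeC (l : G.A₀ →ₗ[ℂ] B) (β : I) :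
    G.A₀ →ₗ[ℂ] CStarMatrix (Fin (G.n β)) (Fin (G.n β)) B where
  toFun a := CStarMatrix.ofMatrix (G.tilde l β a)
  map_add' a b := congrArg CStarMatrix.ofMatrix (map_add (G.tilde l β) a b)
  map_smul' r a := congrArg CStarMatrix.ofMatrix (map_smul (G.tilde l β) r a)

variable {l : G.A₀ →ₗ[ℂ] B}

/-- The legs at `β` form a `*`-homomorphism of `A₀` into `M_{n β}(A₀)`, so this is complete
positivity of `l` at size `m * n β`, regrouped into blocks. -/
theorem Relations.cp_tildeC (h : G.Relations F l) (β : I) (m : ℕ)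
    (Y : Matrix (Fin m) (Fin m) G.A₀) :
    ∃ Z : Matrix (Fin m) (Fin m) (CStarMatrix (Fin (G.n β)) (Fin (G.n β)) B),
      (Y.conjTranspose * Y).map (tildeC l β) = Z.conjTranspose * Z := by
  let e : Fin m × Fin (G.n β) ≃ Fin (m * G.n β) := finProdFinEquiv
  obtain ⟨W, hW⟩ := h.cp (m * G.n β) (Matrix.of fun p q =>
    G.leg₁ β (e.symm p).2 (e.symm q).2 (Y (e.symm p).1 (e.symm q).1))
  refine ⟨Matrix.of fun a b => CStarMatrix.ofMatrix (Matrix.of fun k k' => W (e (a, k)) (e (b, k'))),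
    ?_⟩
  refine Matrix.ext fun a b => CStarMatrix.ext fun k k' => ?_
  have h1 := congrFun (congrFun hW (e (a, k))) (e (b, k'))
  rw [Matrix.map_apply, Matrix.mul_apply, Matrix.mul_apply, ← e.sum_comp, ← e.sum_comp,
    Fintype.sum_prod_type, Fintype.sum_prod_type] at h1
  simp only [Matrix.conjTranspose_apply, Matrix.of_apply, Equiv.symm_apply_apply,
    ← leg₁_star, ← leg₁_mul, ← map_sum] at h1
  have hL : ((Y.conjTranspose * Y).map (tildeC l β)) a b k k'
      = l (G.leg₁ β k k' (∑ c, star (Y c a) * Y c b)) := rfl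
  rw [hL, h1, Matrix.mul_apply]
  have hsum : ∀ (f : Fin m → CStarMatrix (Fin (G.n β)) (Fin (G.n β)) B),
      (∑ c, f c) k k' = ∑ c, f c k k' := fun f =>
    Matrix.sum_apply k k' Finset.univ f
  rw [hsum]
  rfl

theorem Relations.tildeC (h : G.Relations F l) (hG : G.IsDiscreteQuantumGroup) (β : I) :
    G.Relations F (tildeC l β) where
  cp := h.cp_tildeC β
  vanish n := h.vanish (n + 1) β
  sum a := by
    rw [vanishes_sum_iff hG (h.vanish 1 β)]
    obtain ⟨J, hJ⟩ := h.tilde_mul_eq_self hG β a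
    classical
    set K := hG.orthSupp F a with hK
    -- The set `J` provides a unit, while the criterion asks for the unit supported on `K`; by (ii)
    -- the part outside `K` contributes nothing.
    have h1 : Comultiplication.tildeC l β (G.eFin (K ∪ J)) * Comultiplication.tildeC l β a
        = Comultiplication.tildeC l β a :=
      hJ _ fun α hα => eFin_apply_of_mem (Finset.mem_union_right _ hα)
    have h2 : Comultiplication.tildeC l β (G.eFin (K ∪ J) - G.eFin K)
        * Comultiplication.tildeC l β a = 0 := by
      refine h.vanish 1 β _ _ (hG.fOrth fun α hα => ?_) []
      change (G.eFin _).1 α - (G.eFin _).1 α = 0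
      rw [eFin_apply_of_mem hα, eFin_apply_of_mem (Finset.mem_union_left _ hα), sub_self]
    rw [map_sub, sub_mul, sub_eq_zero] at h2
    rw [← h2, h1]

end Tilde

/-! ### The universal property of `E_F` -/

section Universal

variable {F : Finset I}

/-- The coordinates of `E_F`. -/
def ev (s : G.RepNorm F) : G.EF F →⋆ₙₐ[ℂ] s.Alg where
  toFun x := (x : G.EFsub F).1.1 s
  map_smul' _ _ := rfl
  map_zero' := rfl
  map_add' _ _ := rfl
  map_mul' _ _ := rfl
  map_star' _ := rfl

theorem ev_lam (s : G.RepNorm F) (a : G.A₀) : ev s (G.lam F a) = s.map a := rfl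

theorem ext_ev {x y : G.EF F} (h : ∀ s, ev s x = ev s y) : x = y :=
  Subtype.ext (Subtype.ext (funext h))

theorem eq_zero_of_ev {x : G.EF F} (h : ∀ s, ev s x = 0) : x = 0 :=
  ext_ev fun s => (h s).trans (map_zero (ev s)).symm

theorem vanishes_lam (n : ℕ) : G.Vanishes F n (G.lam F) := by
  refine Vanishes.of_forall (C := fun s : G.RepNorm F => s.Alg) n
    (fun s => (ev s).toNonUnitalAlgHom) (fun x hx => eq_zero_of_ev hx) _ fun s => ?_
  exact s.relations.vanish n

/-- All coordinates satisfy the relations and separate points. Positivity and (ii) are detected by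
such families; for (iii), where coordinatewise convergence would not suffice, the algebraic form is
used. -/
theorem relations_lam (hG : G.IsDiscreteQuantumGroup) : G.Relations F (G.lam F) where
  cp m Y := by
    obtain ⟨Z, hZ⟩ := exists_eq_star_mul_self_of_forall
      (B := CStarMatrix (Fin m) (Fin m) (G.EF F))
      (C := fun s : G.RepNorm F => CStarMatrix (Fin m) (Fin m) s.Alg)
      (fun s => CStarMatrix.mapₙₐ (ev s))
      (fun X hX => CStarMatrix.ext fun i j => eq_zero_of_ev fun s =>
        congrFun (congrFun (hX s) i) j)
      (CStarMatrix.ofMatrix ((Y.conjTranspose * Y).map (G.lam F)))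
      (fun s => s.relations.cp m Y)
    exact ⟨Z, hZ⟩
  vanish := vanishes_lam
  sum a := by
    rw [vanishes_sum_iff hG (vanishes_lam 0)]
    refine ext_ev fun s => ?_
    rw [map_mul, ev_lam, ev_lam]
    exact s.relations.mul_eq_self hG fun α hα => eFin_apply_of_mem hα

theorem dense_EF₀ : Dense (G.EF₀ F : Set (G.EF F)) := by
  intro x
  let ι : G.EF F →⋆ₙₐ[ℂ] lp (fun s : G.RepNorm F => s.Alg) ∞ :=
    NonUnitalStarSubalgebraClass.subtype (G.EFsub F)
  have hmap : (G.EF₀ F).map ι = NonUnitalStarAlgebra.adjoin ℂ (Set.range (G.lamProd F)) := by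
    rw [EF₀, NonUnitalStarAlgHom.map_adjoin, ← Set.range_comp]
    rfl
  refine (closure_subtype (x := (show G.EFsub F from x))
    (s := (show Set (G.EFsub F) from (G.EF₀ F : Set (G.EF F))))).2 ?_
  have himg : (ι '' (G.EF₀ F : Set (G.EF F)))
      = (NonUnitalStarAlgebra.adjoin ℂ (Set.range (G.lamProd F)) : Set _) := by
    rw [← hmap]
    rfl
  have hx : ι x ∈ closure (ι '' (G.EF₀ F : Set (G.EF F))) := by
    rw [himg]
    exact (show G.EFsub F from x).2
  exact hx

variable {B : Type u} [NonUnitalCStarAlgebra B] {l : G.A₀ →ₗ[ℂ] B}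

theorem map_polyEval {C : Type u} [NonUnitalCStarAlgebra C] (f : B →⋆ₙₐ[ℂ] C)
    (l : G.A₀ →ₗ[ℂ] B) (l' : G.A₀ →ₗ[ℂ] C) (hf : ∀ a, f (l a) = l' a)
    (p : FreeSemigroup G.A₀ →₀ ℂ) : f (G.polyEval l p) = G.polyEval l' p := by
  have hw : ∀ w : FreeSemigroup G.A₀, f (FreeSemigroup.lift (fun a => l a) w)
      = FreeSemigroup.lift (fun a => l' a) w := by
    intro w
    induction w using FreeSemigroup.recOnMul with
    | ih1 a => simp [hf]
    | ih2 a w ha hw => simp [hf, hw]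
  rw [polyEval, polyEval, Finsupp.sum, Finsupp.sum, map_sum]
  refine Finset.sum_congr rfl fun w _ => ?_
  rw [map_smul, hw]

/-- The seminorm of `l` is one of the indices of the product. The map chosen at that index may
differ from `l`, but it has the same seminorm, and the coordinate map is contractive. -/
theorem Relations.norm_polyEval_le (h : G.Relations F l) (p : FreeSemigroup G.A₀ →₀ ℂ) :
    ‖G.polyEval l p‖ ≤ ‖G.polyEval (G.lam F) p‖ := by
  let s : G.RepNorm F := ⟨fun p => ‖G.polyEval l p‖, B, _, l, h, fun _ => rfl⟩
  have hs : ‖G.polyEval l p‖ = ‖G.polyEval s.map p‖ :=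
    s.2.choose_spec.choose_spec.choose_spec.2 p
  rw [hs, ← map_polyEval (ev s) (G.lam F) s.map (ev_lam s)]
  exact NonUnitalStarAlgHom.norm_apply_le (ev s) _

theorem exists_polyEval (hl : ∀ a, l (star a) = star (l a)) {x : B}
    (hx : x ∈ NonUnitalStarAlgebra.adjoin ℂ (Set.range l)) : ∃ p, x = G.polyEval l p := by
  let Φ : MonoidAlgebra ℂ (FreeSemigroup G.A₀) →ₙₐ[ℂ] B :=
    MonoidAlgebra.liftMagma ℂ (FreeSemigroup.lift fun a => l a)
  have hstar : star (Set.range l) ⊆ Set.range l := by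
    rintro _ ⟨a, ha⟩
    exact ⟨star a, by rw [hl, ha, star_star]⟩
  have hle : NonUnitalAlgebra.adjoin ℂ (Set.range l ∪ star (Set.range l))
      ≤ NonUnitalAlgHom.range Φ := by
    refine NonUnitalAlgebra.adjoin_le ?_
    rw [Set.union_eq_self_of_subset_right hstar]
    rintro _ ⟨a, rfl⟩
    refine ⟨MonoidAlgebra.single (FreeSemigroup.of a) 1, ?_⟩
    change MonoidAlgebra.liftMagma ℂ _ (MonoidAlgebra.single _ 1) = l a
    simp
  obtain ⟨p, hp⟩ := hle hx
  exact ⟨p.coeff, hp.symm⟩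

/-- The lift is obtained from its graph: the closed `*`-algebra `T` generated by the pairs `(λ(a),
l(a))` projects bijectively onto `E_F`, and the second projection composed with the inverse is the
lift. -/
theorem Relations.exists_lift (h : G.Relations F l) (hG : G.IsDiscreteQuantumGroup) :
    ∃ ψ : G.EF F →⋆ₙₐ[ℂ] B, ∀ a, ψ (G.lam F a) = l a := by
  let j : G.A₀ →ₗ[ℂ] G.EF F × B := (G.lam F).prod l
  let S := NonUnitalStarAlgebra.adjoin ℂ (Set.range j)
  let T := S.topologicalClosure
  have hT : IsClosed (T : Set (G.EF F × B)) := S.isClosed_topologicalClosure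
  have hj : ∀ a, j (star a) = star (j a) := fun a =>
    Prod.ext ((relations_lam hG).map_star a) (h.map_star a)
  have hle : ∀ x ∈ T, ‖x.2‖ ≤ ‖x.1‖ := by
    intro x hx
    have hcl : IsClosed {x : G.EF F × B | ‖x.2‖ ≤ ‖x.1‖} :=
      isClosed_le (continuous_snd.norm) (continuous_fst.norm)
    refine closure_minimal (fun y hy => ?_) hcl hx
    obtain ⟨p, rfl⟩ := exists_polyEval hj hy
    change ‖NonUnitalStarAlgHom.snd ℂ (G.EF F) B _‖ ≤ ‖NonUnitalStarAlgHom.fst ℂ (G.EF F) B _‖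
    rw [map_polyEval (NonUnitalStarAlgHom.snd ℂ (G.EF F) B) j l fun _ => rfl,
      map_polyEval (NonUnitalStarAlgHom.fst ℂ (G.EF F) B) j (G.lam F) fun _ => rfl]
    exact h.norm_polyEval_le p
  let _ : NonUnitalCStarAlgebra T :=
    NonUnitalStarSubalgebra.nonUnitalCStarAlgebra T (h_closed := hT)
  let ι : T →⋆ₙₐ[ℂ] G.EF F × B := NonUnitalStarSubalgebraClass.subtype T
  let π : T →⋆ₙₐ[ℂ] G.EF F := (NonUnitalStarAlgHom.fst ℂ (G.EF F) B).comp ι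
  have hinj : Function.Injective π := by
    rw [injective_iff_map_eq_zero]
    intro x hx
    have hx1 : x.1.1 = 0 := hx
    have h2 := hle x.1 x.2
    rw [hx1, norm_zero] at h2
    exact Subtype.ext (Prod.ext hx1 (norm_le_zero_iff.1 h2))
  have hmem : ∀ a, j a ∈ T := fun a => S.le_topologicalClosure
    (NonUnitalStarAlgebra.subset_adjoin ℂ _ ⟨a, rfl⟩)
  -- An injective `*`-homomorphism of C⋆-algebras is isometric, so the range is closed; it contains
  -- the dense subalgebra of the generators.
  have hsurj : Function.Surjective π := by
    have hclosed : IsClosed (Set.range π) :=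
      (NonUnitalStarAlgHom.isometry π hinj).isClosedEmbedding.isClosed_range
    have hsub : (G.EF₀ F : Set (G.EF F)) ⊆ Set.range π := by
      have : G.EF₀ F ≤ NonUnitalStarAlgHom.range π := by
        refine NonUnitalStarAlgebra.adjoin_le ?_
        rintro _ ⟨a, rfl⟩
        exact ⟨⟨j a, hmem a⟩, rfl⟩
      exact this
    intro x
    exact closure_minimal hsub hclosed (dense_EF₀ x)
  let e := StarAlgEquiv.ofBijective π ⟨hinj, hsurj⟩
  refine ⟨((NonUnitalStarAlgHom.snd ℂ (G.EF F) B).comp ι).comp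
    (e.symm : G.EF F →⋆ₙₐ[ℂ] T), fun a => ?_⟩
  have he : e.symm (G.lam F a) = ⟨j a, hmem a⟩ := by
    rw [StarAlgEquiv.symm_apply_eq]
    rfl
  change (e.symm (G.lam F a)).1.2 = l a
  rw [he]
  rfl

end Universal

end Comultiplication

namespace Comultiplication

variable {I : Type u} {G : Comultiplication I} {F : Finset I}

attribute [local instance] CStarAlgebra.spectralOrder CStarAlgebra.spectralOrderedRing

/-! ### Construction and uniqueness of `Δ_F` -/

section Psi

/-- No case for adjoints is needed, because the set of generators is already self-adjoint. -/
theorem EF₀_induction {p : G.EF F → Prop} (hlam : ∀ a, p (G.lam F a))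
    (hadd : ∀ x y, p x → p y → p (x + y)) (hzero : p 0) (hmul : ∀ x y, p x → p y → p (x * y))
    (hsmul : ∀ (r : ℂ) x, p x → p (r • x)) (hG : G.IsDiscreteQuantumGroup)
    {x : G.EF F} (hx : x ∈ G.EF₀ F) : p x := by
  have hstar : star (Set.range (G.lam F)) ⊆ Set.range (G.lam F) := by
    rintro _ ⟨a, ha⟩
    exact ⟨star a, by rw [(relations_lam hG).map_star, ha, star_star]⟩
  have hx' : x ∈ NonUnitalAlgebra.adjoin ℂ (Set.range (G.lam F) ∪ star (Set.range (G.lam F))) := hx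
  rw [Set.union_eq_self_of_subset_right hstar] at hx'
  clear hx
  induction hx' using NonUnitalAlgebra.adjoin_induction with
  | mem x hx => obtain ⟨a, rfl⟩ := hx; exact hlam a
  | add x y _ _ h1 h2 => exact hadd x y h1 h2
  | zero => exact hzero
  | mul x y _ _ h1 h2 => exact hmul x y h1 h2
  | smul r x _ h => exact hsmul r x h

theorem lam_mem (a : G.A₀) : G.lam F a ∈ G.EF₀ F :=
  NonUnitalStarAlgebra.subset_adjoin ℂ _ ⟨a, rfl⟩

variable (hG : G.IsDiscreteQuantumGroup)

/-- The component `E_F → E_F ⊗ A_β` of `Δ_F`. -/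
def psi (β : I) : G.EF F →⋆ₙₐ[ℂ] CStarMatrix (Fin (G.n β)) (Fin (G.n β)) (G.EF F) :=
  (((relations_lam hG).tildeC hG β).exists_lift hG).choose

theorem psi_lam (β : I) (a : G.A₀) (k k' : Fin (G.n β)) :
    psi hG β (G.lam F a) k k' = G.lam F (G.leg₁ β k k' a) := by
  rw [psi, (((relations_lam hG).tildeC hG β).exists_lift hG).choose_spec a]
  rfl

theorem psi_mul (β : I) (x y : G.EF F) (k k' : Fin (G.n β)) :
    psi hG β (x * y) k k' = ∑ m, psi hG β x k m * psi hG β y m k' := by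
  rw [map_mul]
  rfl

theorem psi_add (β : I) (x y : G.EF F) (k k' : Fin (G.n β)) :
    psi hG β (x + y) k k' = psi hG β x k k' + psi hG β y k k' := by
  rw [map_add]
  rfl

theorem psi_smul (β : I) (r : ℂ) (x : G.EF F) (k k' : Fin (G.n β)) :
    psi hG β (r • x) k k' = r • psi hG β x k k' := by
  rw [map_smul]
  rfl

theorem psi_zero (β : I) (k k' : Fin (G.n β)) : psi hG β (0 : G.EF F) k k' = 0 := by
  rw [map_zero]
  rfl

theorem continuous_hom {A B : Type*} [NonUnitalCStarAlgebra A] [NonUnitalCStarAlgebra B]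
    (f : A →⋆ₙₐ[ℂ] B) : Continuous f :=
  AddMonoidHomClass.continuous_of_bound f 1
    (by simpa only [one_mul] using NonUnitalStarAlgHom.norm_apply_le f)

theorem continuous_psi (β : I) (k k' : Fin (G.n β)) :
    Continuous fun x : G.EF F => psi hG β x k k' := by
  have h : Continuous fun X : CStarMatrix (Fin (G.n β)) (Fin (G.n β)) (G.EF F) => X k k' :=
    (continuous_apply k').comp (continuous_apply (A := fun _ => Fin (G.n β) → G.EF F) k)
  exact h.comp (continuous_hom (psi hG β))

/-- The component of `Δ_F` in `M_{n β}(M(E_F))`. -/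
def psiM (β : I) : G.EF F →⋆ₙₐ[ℂ] CStarMatrix (Fin (G.n β)) (Fin (G.n β)) 𝓜(ℂ, G.EF F) :=
  (CStarMatrix.mapₙₐ (DoubleCentralizer.coeHom (𝕜 := ℂ) (A := G.EF F))).comp (psi hG β)

/-- The coaction `Δ_F`. -/
def deltaF : G.EF F →⋆ₙₐ[ℂ] G.MulTensor (G.EF F) where
  toFun x := ⟨fun β => CStarMatrix.ofMatrix.symm (psiM hG β x), ‖x‖, fun β =>
    NonUnitalStarAlgHom.norm_apply_le (psiM hG β) x⟩
  map_smul' r x := Subtype.ext (funext fun β => map_smul (psiM hG β) r x)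
  map_zero' := Subtype.ext (funext fun β => map_zero (psiM hG β))
  map_add' x y := Subtype.ext (funext fun β => map_add (psiM hG β) x y)
  map_mul' x y := Subtype.ext (funext fun β => map_mul (psiM hG β) x y)
  map_star' x := Subtype.ext (funext fun β => map_star (psiM hG β) x)

theorem deltaF_apply (x : G.EF F) (β : I) (k k' : Fin (G.n β)) :
    (deltaF hG x).1 β k k' = DoubleCentralizer.coe ℂ (psi hG β x k k') := rfl

theorem isDeltaF_deltaF : G.IsDeltaF F (deltaF hG) := fun a β k k' => by
  rw [deltaF_apply, psi_lam]
  rfl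

/-- The component of a `*`-homomorphism into `M(C ⊗ A)`. -/
def component {C : Type u} [NonUnitalCStarAlgebra C] (δ : C →⋆ₙₐ[ℂ] G.MulTensor C) (β : I) :
    C →⋆ₙₐ[ℂ] CStarMatrix (Fin (G.n β)) (Fin (G.n β)) 𝓜(ℂ, C) where
  toFun x := CStarMatrix.ofMatrix ((δ x).1 β)
  map_smul' r x := by rw [map_smul]; rfl
  map_zero' := by rw [map_zero]; rfl
  map_add' x y := by rw [map_add]; rfl
  map_mul' x y := by rw [map_mul]; rfl
  map_star' x := by rw [map_star]; rfl

/-- Each component is a `*`-homomorphism between C⋆-algebras, hence continuous, and so determined by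
the generators. -/
theorem IsDeltaF.unique (hG : G.IsDiscreteQuantumGroup)
    {δ δ' : G.EF F →⋆ₙₐ[ℂ] G.MulTensor (G.EF F)} (h : G.IsDeltaF F δ)
    (h' : G.IsDeltaF F δ') : δ' = δ := by
  have hβ : ∀ β x, component δ' β x = component δ β x := by
    intro β
    have hset : IsClosed {x | component δ' β x = component δ β x} :=
      isClosed_eq (continuous_hom _) (continuous_hom _)
    intro x
    refine closure_minimal (s := (G.EF₀ F : Set (G.EF F))) (fun y hy => ?_) hset (dense_EF₀ x)
    refine EF₀_induction (p := fun y => component δ' β y = component δ β y) ?_ ?_ ?_ ?_ ?_ hG hy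
    · exact fun a => CStarMatrix.ext fun k k' => (h' a β k k').trans (h a β k k').symm
    · intro x y hx hy
      rw [map_add, map_add, hx, hy]
    · rw [map_zero, map_zero]
    · intro x y hx hy
      rw [map_mul, map_mul, hx, hy]
    · intro r x hx
      rw [map_smul, map_smul, hx]
  exact DFunLike.ext _ _ fun x => Subtype.ext (funext fun β => hβ β x)

end Psi

/-! ### Coassociativity -/

section Coassoc

variable {B : Type*} [NonUnitalRing B] [Module ℂ B] [IsScalarTower ℂ B B] [SMulCommClass ℂ B B]
variable {κ : Type*} [Fintype κ]

/-- `b ⊗ U` as a matrix over `B`. -/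
def smulMat (U : Matrix κ κ ℂ) (b : B) : Matrix κ κ B := U.map fun z => z • b

theorem smulMat_mul (U V : Matrix κ κ ℂ) (b c : B) :
    smulMat U b * smulMat V c = smulMat (U * V) (b * c) := by
  ext p q
  simp [smulMat, Matrix.mul_apply, Finset.sum_smul, smul_mul_smul_comm]

theorem smulMat_zero_left {B κ : Type*} [NonUnitalRing B] [Module ℂ B] (b : B) :
    smulMat (0 : Matrix κ κ ℂ) b = 0 := by
  ext p q
  simp [smulMat]

theorem smulMat_sum {B κ ι : Type*} [NonUnitalRing B] [Module ℂ B] (s : Finset ι)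
    (U : Matrix κ κ ℂ) (f : ι → B) :
    smulMat U (∑ x ∈ s, f x) = ∑ x ∈ s, smulMat U (f x) := by
  ext p q
  simp [smulMat, Finset.smul_sum, Matrix.sum_apply]

/-- `(id ⊗ Δ)(X)` in the block `(β, γ)`, for `X ∈ B ⊗ A_α`. -/
def blockMap (α β γ : I) (X : Matrix (Fin (G.n α)) (Fin (G.n α)) B) :
    Matrix (Fin (G.n β) × Fin (G.n γ)) (Fin (G.n β) × Fin (G.n γ)) B :=
  ∑ i, ∑ i', smulMat (G.com (AlgSum.unit α i i') β γ) (X i i')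

/-- This is the multiplicativity of `Δ` on products of matrix units. -/
theorem blockMap_mul (α β γ : I) (X Y : Matrix (Fin (G.n α)) (Fin (G.n α)) B) :
    blockMap α β γ X * blockMap α β γ Y = blockMap α β γ (X * Y) := by
  have hterm : ∀ i i', smulMat (G.com (AlgSum.unit α i i') β γ) (X i i') * blockMap α β γ Y
      = ∑ j, smulMat (G.com (AlgSum.unit α i j) β γ) (X i i' * Y i' j) := by
    intro i i'
    rw [blockMap, Finset.mul_sum, Finset.sum_eq_single i', Finset.mul_sum]
    · refine Finset.sum_congr rfl fun j _ => ?_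
      rw [smulMat_mul, ← com_mul, unit_mul_unit, if_pos rfl]
    · intro r _ hr
      rw [Finset.mul_sum]
      refine Finset.sum_eq_zero fun j _ => ?_
      rw [smulMat_mul, ← com_mul, unit_mul_unit, if_neg hr.symm, com_zero, smulMat_zero_left]
    · exact fun hc => absurd (Finset.mem_univ i') hc
  conv_lhs => rw [blockMap]
  simp only [Finset.sum_mul, hterm]
  rw [blockMap]
  simp only [Matrix.mul_apply, smulMat_sum]
  exact Finset.sum_congr rfl fun i _ => Finset.sum_comm

theorem blockMap_mul_of_ne {α α' : I} (h : α ≠ α') (β γ : I)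
    (X : Matrix (Fin (G.n α)) (Fin (G.n α)) B) (Y : Matrix (Fin (G.n α')) (Fin (G.n α')) B) :
    blockMap α β γ X * blockMap α' β γ Y = 0 := by
  simp only [blockMap, Finset.sum_mul, Finset.mul_sum, smulMat_mul, ← com_mul]
  refine Finset.sum_eq_zero fun i _ => Finset.sum_eq_zero fun i' _ => Finset.sum_eq_zero fun j _ =>
    Finset.sum_eq_zero fun j' _ => ?_
  rw [AlgSum.unit, AlgSum.unit, single_mul_single_of_ne, com_zero, smulMat_zero_left]
  exact h

theorem blockMap_apply {B : Type*} [NonUnitalRing B] [Module ℂ B] (α β γ : I)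
    (X : Matrix (Fin (G.n α)) (Fin (G.n α)) B)
    (p q : Fin (G.n β) × Fin (G.n γ)) : blockMap α β γ X p q
      = ∑ i, ∑ i', G.com (AlgSum.unit α i i') β γ p q • X i i' := by
  simp [blockMap, Matrix.sum_apply, smulMat]

variable (hG : G.IsDiscreteQuantumGroup)

/-- Both sides are continuous, linear and multiplicative in `c` as matrices over `E_F`; on
generators the identity is `leg₁_leg₁`. -/
theorem psi_psi (c : G.EF F) (β γ : I) (j j' : Fin (G.n β)) (k k' : Fin (G.n γ)) :
    psi hG β (psi hG γ c k k') j j' = ∑ α ∈ hG.comSupp β γ, ∑ i, ∑ i',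
      G.com (AlgSum.unit α i i') β γ (j, k) (j', k') • psi hG α c i i' := by
  have hset : IsClosed {c : G.EF F | ∀ j j' k k', psi hG β (psi hG γ c k k') j j'
      = ∑ α ∈ hG.comSupp β γ, ∑ i, ∑ i',
        G.com (AlgSum.unit α i i') β γ (j, k) (j', k') • psi hG α c i i'} := by
    simp only [Set.ofPred_forall]
    refine isClosed_iInter fun j => isClosed_iInter fun j' => isClosed_iInter fun k =>
      isClosed_iInter fun k' => isClosed_eq ?_ ?_
    · exact (continuous_psi hG β j j').comp (continuous_psi hG γ k k')
    · exact continuous_finsetSum _ fun α _ => continuous_finsetSum _ fun i _ =>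
        continuous_finsetSum _ fun i' _ => (continuous_const_smul _).comp (continuous_psi hG α i i')
  refine closure_minimal (s := (G.EF₀ F : Set (G.EF F))) (fun y hy => ?_) hset (dense_EF₀ c)
    j j' k k'
  refine EF₀_induction (p := fun c => ∀ j j' k k', psi hG β (psi hG γ c k k') j j'
      = ∑ α ∈ hG.comSupp β γ, ∑ i, ∑ i',
        G.com (AlgSum.unit α i i') β γ (j, k) (j', k') • psi hG α c i i') ?_ ?_ ?_ ?_ ?_ hG hy
  · intro a j j' k k'
    rw [psi_lam, psi_lam, hG.leg₁_leg₁]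
    simp only [map_sum, map_smul, psi_lam]
  · intro x y hx hy j j' k k'
    simp only [psi_add, hx, hy, smul_add, Finset.sum_add_distrib]
  · intro j j' k k'
    simp only [psi_zero, smul_zero, Finset.sum_const_zero]
  · intro x y hx hy j j' k k'
    let T : G.EF F → Matrix (Fin (G.n β) × Fin (G.n γ)) (Fin (G.n β) × Fin (G.n γ)) (G.EF F) :=
      fun c => Matrix.of fun p q => psi hG β (psi hG γ c p.2 q.2) p.1 q.1
    let M : ∀ α, G.EF F → Matrix (Fin (G.n α)) (Fin (G.n α)) (G.EF F) :=
      fun α c => CStarMatrix.ofMatrix.symm (psi hG α c)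
    let R : G.EF F → Matrix (Fin (G.n β) × Fin (G.n γ)) (Fin (G.n β) × Fin (G.n γ)) (G.EF F) :=
      fun c => ∑ α ∈ hG.comSupp β γ, blockMap α β γ (M α c)
    have hR : ∀ c p q, R c p q = ∑ α ∈ hG.comSupp β γ, ∑ i, ∑ i',
        G.com (AlgSum.unit α i i') β γ p q • psi hG α c i i' := by
      intro c p q
      simp only [R, Matrix.sum_apply, blockMap_apply]
      rfl
    have hTx : T x = R x := by ext p q; rw [hR]; exact hx _ _ _ _
    have hTy : T y = R y := by ext p q; rw [hR]; exact hy _ _ _ _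
    have hM : ∀ α, M α (x * y) = M α x * M α y := fun α => map_mul (psi hG α) x y
    have hmulR : R x * R y = R (x * y) := by
      simp only [R]
      rw [Finset.sum_mul_sum]
      refine Finset.sum_congr rfl fun α hα => ?_
      -- The cross terms vanish since distinct blocks `A_α` are orthogonal.
      rw [Finset.sum_eq_single α, blockMap_mul, hM]
      · exact fun α' _ h => blockMap_mul_of_ne h.symm β γ _ _
      · exact fun hc => absurd hα hc
    have hmulT : T x * T y = T (x * y) := by
      ext p q
      rw [Matrix.mul_apply, Fintype.sum_prod_type, Finset.sum_comm]
      simp only [T, Matrix.of_apply, psi_mul]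
      have hsum : ∀ (f : Fin (G.n γ) → G.EF F), psi hG β (∑ m, f m) p.1 q.1
          = ∑ m, psi hG β (f m) p.1 q.1 := by
        intro f
        rw [map_sum]
        exact Matrix.sum_apply _ _ Finset.univ fun m =>
          CStarMatrix.ofMatrix.symm (psi hG β (f m))
      simp only [hsum, psi_mul]
    have := congrFun (congrFun (hmulT.symm.trans (by rw [hTx, hTy, hmulR])) (j, k)) (j', k')
    rw [hR] at this
    exact this
  · intro r x hx j j' k k'
    simp only [psi_smul, hx, Finset.smul_sum, smul_comm r]

theorem isCoassociative_deltaF : IsCoassociative (deltaF (F := F) hG) := by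
  classical
  intro c γ k k'
  refine ⟨psi hG γ c k k', rfl, fun β j j' => ?_⟩
  have hcoe : ∀ x : G.EF F, DoubleCentralizer.coe ℂ x = DoubleCentralizer.coeHom (𝕜 := ℂ) x :=
    fun _ => rfl
  rw [deltaF_apply, psi_psi, idComp, finsum_eq_sum_of_support_subset (s := hG.comSupp β γ)]
  · simp only [deltaF_apply, hcoe, map_sum, map_smul]
  · intro α hα
    by_contra hc
    refine hα (Finset.sum_eq_zero fun i _ => Finset.sum_eq_zero fun i' _ => ?_)
    rw [hG.com_eq_zero, Matrix.zero_apply, zero_smul]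
    intro δ hδ
    refine single_apply_of_ne ?_ _
    rintro rfl
    exact hc hδ

end Coassoc

end Comultiplication

namespace Comultiplication

/-! ### Slices with the Haar measure -/

section Gram

open scoped ComplexOrder MatrixOrder

theorem exists_eq_conjTranspose_mul_self {k : Type*} [Fintype k] {M : Matrix k k ℂ}
    (hH : M.IsHermitian)
    (h : ∀ x : k → ℂ, 0 ≤ (star x ⬝ᵥ M.mulVec x).re ∧ (star x ⬝ᵥ M.mulVec x).im = 0) :
    ∃ P : Matrix k k ℂ, M = P.conjTranspose * P := by
  classical
  have hM : M.PosSemidef := .of_dotProduct_mulVec_nonneg hH fun x =>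
    Complex.le_def.2 ⟨(h x).1, (h x).2.symm⟩
  obtain ⟨P, hP⟩ := CStarAlgebra.nonneg_iff_eq_star_mul_self.mp hM.nonneg
  exact ⟨P, hP⟩

end Gram

variable {I : Type u} {G : Comultiplication I} {F : Finset I}

/-- The element `(id ⊗ φ)(Δ(a)(1 ⊗ e_β))` of `A₀`. -/
def sliceA (φ : G.A₀ →ₗ[ℂ] ℂ) (a : G.A₀) (β : I) : G.A₀ :=
  ∑ k, ∑ k', φ (AlgSum.unit β k k') • G.leg₁ β k k' a

section Haar

variable {φ : G.A₀ →ₗ[ℂ] ℂ}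

theorem IsLeftHaar.map_star_mul (hφ : G.IsLeftHaar φ) (x y : G.A₀) :
    φ (star y * x) = star (φ (star x * y)) := by
  have ex : ∀ r : ℂ, φ (star (x + r • y) * (x + r • y)) = φ (star x * x) + r * φ (star x * y)
      + star r * φ (star y * x) + (star r * r) * φ (star y * y) := by
    intro r
    have : star (x + r • y) * (x + r • y) = star x * x + r • (star x * y)
        + star r • (star y * x) + (star r * r) • (star y * y) := by
      rw [star_add, star_smul, add_mul, mul_add, mul_add, smul_mul_assoc, smul_mul_assoc,
        mul_smul_comm, mul_smul_comm, smul_smul]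
      abel
    rw [this]
    simp only [map_add, map_smul, smul_eq_mul]
  have h1 := (hφ.nonneg (x + (1 : ℂ) • y)).2
  have h2 := (hφ.nonneg (x + Complex.I • y)).2
  have hx := (hφ.nonneg x).2
  have hy := (hφ.nonneg y).2
  rw [ex] at h1 h2
  -- Polarization: positivity at `x + iy` gives equality of the real parts, at `x + y` that of the
  -- imaginary parts.
  apply Complex.ext
  · simp [hx, hy] at h2 ⊢
    linarith
  · simp [hx, hy] at h1 ⊢
    linarith

/-- The density of `φ` on a block is a Gram matrix. -/
theorem IsLeftHaar.exists_gram (hφ : G.IsLeftHaar φ) (β : I) :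
    ∃ P : Matrix (Fin (G.n β)) (Fin (G.n β)) ℂ, ∀ k k',
      φ (AlgSum.unit β k k') = ∑ m, star (P m k) * P m k' := by
  -- A fixed row `o` writes `e_{kk'}` as `e_{ok}* e_{ok'}`, so positivity of `φ` makes the matrix of
  -- the `φ(e_{kk'})` positive semidefinite.
  let o : Fin (G.n β) := ⟨0, G.n_pos β⟩
  have hunit : ∀ k k' : Fin (G.n β), (AlgSum.unit β k k' : G.A₀)
      = star (AlgSum.unit β o k) * AlgSum.unit β o k' := by
    intro k k'
    rw [star_unit, unit_mul_unit, if_pos rfl]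
  obtain ⟨P, hP⟩ := exists_eq_conjTranspose_mul_self
    (M := Matrix.of fun k k' => φ (AlgSum.unit β k k' : G.A₀))
    (by
      ext k k'
      rw [Matrix.conjTranspose_apply, Matrix.of_apply, Matrix.of_apply, hunit k' k, hunit k k',
        ← hφ.map_star_mul])
    (fun x => by
      have hx : star x ⬝ᵥ (Matrix.of fun k k' => φ (AlgSum.unit β k k' : G.A₀)).mulVec x
          = φ (star (∑ k, x k • (AlgSum.unit β o k : G.A₀)) * ∑ k, x k • AlgSum.unit β o k) := by
        simp only [dotProduct, Matrix.mulVec, Matrix.of_apply, star_sum, star_smul, Finset.sum_mul,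
          Finset.mul_sum, smul_mul_assoc, mul_smul_comm, map_sum, map_smul, smul_eq_mul,
          ← hunit, Pi.star_apply]
        rw [Finset.sum_comm]
        refine Finset.sum_congr rfl fun k _ => Finset.sum_congr rfl fun k' _ => ?_
        ring
      rw [hx]
      exact hφ.nonneg _)
  refine ⟨P, fun k k' => ?_⟩
  have := congrFun (congrFun hP k) k'
  rw [Matrix.of_apply, Matrix.mul_apply] at this
  simpa only [Matrix.conjTranspose_apply] using this

/-- With `φ(e_{kk'})` factored as a Gram matrix, the slice of `Δ(b)*Δ(b)` becomes a sum of squares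
of combinations of the legs of `b`. This form lets complete positivity of `λ` apply. -/
theorem IsLeftHaar.sliceA_eq_sum (hφ : G.IsLeftHaar φ) (b : G.A₀) (β : I) :
    ∃ y : Fin (G.n β) → Fin (G.n β) → G.A₀,
      sliceA φ (star b * b) β = ∑ l, ∑ m, star (y l m) * y l m := by
  obtain ⟨P, hP⟩ := hφ.exists_gram β
  refine ⟨fun l m => ∑ k, P m k • G.leg₁ β l k b, ?_⟩
  have hterm : ∀ l m, star (∑ k, P m k • G.leg₁ β l k b) * ∑ k, P m k • G.leg₁ β l k b
      = ∑ k, ∑ k', (star (P m k) * P m k') • (star (G.leg₁ β l k b) * G.leg₁ β l k' b) := by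
    intro l m
    rw [star_sum, Finset.sum_mul_sum]
    refine Finset.sum_congr rfl fun k _ => Finset.sum_congr rfl fun k' _ => ?_
    rw [star_smul, smul_mul_smul_comm]
  have hslice : ∀ k k', φ (AlgSum.unit β k k') • G.leg₁ β k k' (star b * b)
      = ∑ l, ∑ m, (star (P m k) * P m k') • (star (G.leg₁ β l k b) * G.leg₁ β l k' b) := by
    intro k k'
    rw [hP, leg₁_mul, Finset.smul_sum]
    refine Finset.sum_congr rfl fun l _ => ?_
    rw [leg₁_star, Finset.sum_smul]
  simp only [sliceA, hterm, hslice]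
  rw [Finset.sum_congr rfl fun k _ => Finset.sum_comm, Finset.sum_comm]
  refine Finset.sum_congr rfl fun l _ => ?_
  rw [Finset.sum_congr rfl fun k _ => Finset.sum_comm, Finset.sum_comm]

/-- Invariance: the slices of `Δ(a)` add up to `φ(a) 1`. -/
theorem IsLeftHaar.exists_sum_sliceA (hφ : G.IsLeftHaar φ) (a : G.A₀) (K : Finset I) :
    ∃ S : Finset I, ∀ J, S ⊆ J → ∀ γ ∈ K, (∑ β ∈ J, sliceA φ a β).1 γ = φ a • 1 := by
  classical
  refine ⟨K.biUnion fun γ => Finset.univ.biUnion fun i => Finset.univ.biUnion fun i' =>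
    supp (G.leg₂ γ i i' a), fun J hJ γ hγ => ?_⟩
  have hinv := hφ.invariant a (AlgSum.e γ) γ
  rw [show (AlgSum.e γ : G.A₀).1 γ = 1 from single_apply_self γ 1, one_mul] at hinv
  rw [← hinv]
  ext i i'
  -- Expanded in matrix units over `J`, the left leg is evaluated by `φ` to exactly the entries of
  -- the slices.
  rw [Matrix.of_apply, eq_sum_unit (G.leg₂ γ i i' a) (J := J)]
  · simp only [coe_sum_apply, Matrix.sum_apply, map_sum, map_smul, sliceA]
    refine Finset.sum_congr rfl fun β _ => Finset.sum_congr rfl fun k _ =>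
      Finset.sum_congr rfl fun k' _ => ?_
    rw [smul_eq_mul, mul_comm]
    rfl
  · intro α hα
    refine hJ ?_
    simp only [Finset.mem_biUnion, Finset.mem_univ, true_and]
    exact ⟨γ, hγ, i, i', mem_supp.2 hα⟩

end Haar

/-! ### Local units -/

section LocalUnits

variable (hG : G.IsDiscreteQuantumGroup)

theorem star_eFin (K : Finset I) : star (G.eFin K) = G.eFin K := by
  rw [eFin, star_sum]
  refine Finset.sum_congr rfl fun α _ => ?_
  rw [← e_star_mul α, star_mul, star_star]

theorem eFin_mul_lam (hG : G.IsDiscreteQuantumGroup) {b : G.A₀} {K : Finset I}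
    (hK : hG.orthSupp F b ⊆ K) : G.lam F (G.eFin K) * G.lam F b = G.lam F b :=
  (relations_lam hG).mul_eq_self hG fun _ hα => eFin_apply_of_mem (hK hα)

theorem lam_mul_eFin (hG : G.IsDiscreteQuantumGroup) {b : G.A₀} {K : Finset I}
    (hK : hG.orthSupp F (star b) ⊆ K) : G.lam F b * G.lam F (G.eFin K) = G.lam F b := by
  have h := congrArg star (eFin_mul_lam hG hK)
  rwa [star_mul, ← (relations_lam hG).map_star, ← (relations_lam hG).map_star, star_star,
    star_eFin] at h

/-- The elements of `E_F` that have some `λ(e_K)` as a unit. -/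
def localAlg (G : Comultiplication I) (F : Finset I) (hG : G.IsDiscreteQuantumGroup) :
    NonUnitalStarSubalgebra ℂ (G.EF F) where
  -- Requiring the unit property for all larger `K` makes the set closed under sums and products.
  carrier := {c | ∃ J : Finset I, ∀ K, J ⊆ K →
    G.lam F (G.eFin K) * c = c ∧ c * G.lam F (G.eFin K) = c}
  add_mem' := by
    classical
    rintro x y ⟨J, hJ⟩ ⟨L, hL⟩
    refine ⟨J ∪ L, fun K hK => ?_⟩
    obtain ⟨h1, h2⟩ := hJ K (Finset.union_subset_left hK)
    obtain ⟨h3, h4⟩ := hL K (Finset.union_subset_right hK)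
    exact ⟨by rw [mul_add, h1, h3], by rw [add_mul, h2, h4]⟩
  zero_mem' := ⟨∅, fun K _ => ⟨mul_zero _, zero_mul _⟩⟩
  mul_mem' := by
    classical
    rintro x y ⟨J, hJ⟩ ⟨L, hL⟩
    refine ⟨J ∪ L, fun K hK => ?_⟩
    exact ⟨by rw [← mul_assoc, (hJ K (Finset.union_subset_left hK)).1],
      by rw [mul_assoc, (hL K (Finset.union_subset_right hK)).2]⟩
  smul_mem' := by
    rintro r x ⟨J, hJ⟩
    refine ⟨J, fun K hK => ?_⟩
    exact ⟨by rw [mul_smul_comm, (hJ K hK).1], by rw [smul_mul_assoc, (hJ K hK).2]⟩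
  star_mem' := by
    rintro x ⟨J, hJ⟩
    refine ⟨J, fun K hK => ?_⟩
    have hs : star (G.lam F (G.eFin K)) = G.lam F (G.eFin K) := by
      rw [← (relations_lam hG).map_star, star_eFin]
    have h1 := congrArg star (hJ K hK).1
    have h2 := congrArg star (hJ K hK).2
    rw [star_mul, hs] at h1 h2
    exact ⟨h2, h1⟩

theorem lam_mem_localAlg (b : G.A₀) : G.lam F b ∈ localAlg G F hG := by
  classical
  exact ⟨hG.orthSupp F b ∪ hG.orthSupp F (star b), fun K hK =>
    ⟨eFin_mul_lam hG (Finset.union_subset_left hK), lam_mul_eFin hG (Finset.union_subset_right hK)⟩⟩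

theorem EF₀_le_localAlg : G.EF₀ F ≤ localAlg G F hG := by
  refine NonUnitalStarAlgebra.adjoin_le ?_
  rintro _ ⟨b, rfl⟩
  exact lam_mem_localAlg hG b

/-! ### Stability under the components of `Δ_F`, and the conditions A1 and A2 -/

theorem psi_mem_EF₀ {c : G.EF F} (hc : c ∈ G.EF₀ F) (β : I) (k k' : Fin (G.n β)) :
    psi hG β c k k' ∈ G.EF₀ F := by
  refine EF₀_induction (p := fun c => ∀ k k', psi hG β c k k' ∈ G.EF₀ F) ?_ ?_ ?_ ?_ ?_ hG hc k k'
  · intro a k k'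
    rw [psi_lam]
    exact lam_mem _
  · intro x y hx hy k k'
    rw [psi_add]
    exact add_mem (hx k k') (hy k k')
  · intro k k'
    rw [psi_zero]
    exact zero_mem _
  · intro x y hx hy k k'
    rw [psi_mul]
    exact sum_mem fun m _ => mul_mem (hx k m) (hy m k')
  · intro r x hx k k'
    rw [psi_smul]
    exact SMulMemClass.smul_mem r (hx k k')

/-- Write `c = λ(e_J)c = cλ(e_J)`: the outer factors of the components are then values of `λ`, which
have local units. -/
theorem psi_mem_localAlg {c : G.EF F} (hc : c ∈ localAlg G F hG) (β : I) (k k' : Fin (G.n β)) :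
    psi hG β c k k' ∈ localAlg G F hG := by
  classical
  obtain ⟨J, hJ⟩ := hc
  obtain ⟨h1, h2⟩ := hJ J subset_rfl
  refine ⟨(Finset.univ.biUnion fun m => hG.orthSupp F (G.leg₁ β k m (G.eFin J))) ∪
    Finset.univ.biUnion fun m => hG.orthSupp F (star (G.leg₁ β m k' (G.eFin J))),
    fun K hK => ⟨?_, ?_⟩⟩
  · rw [← h1, psi_mul, Finset.mul_sum]
    refine Finset.sum_congr rfl fun m _ => ?_
    rw [psi_lam, ← mul_assoc, eFin_mul_lam hG]
    exact (Finset.subset_biUnion_of_mem (fun m => hG.orthSupp F (G.leg₁ β k m (G.eFin J)))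
      (Finset.mem_univ m)).trans (Finset.union_subset_left hK)
  · rw [← h2, psi_mul, Finset.sum_mul]
    refine Finset.sum_congr rfl fun m _ => ?_
    rw [psi_lam, mul_assoc, lam_mul_eFin hG]
    exact (Finset.subset_biUnion_of_mem (fun m => hG.orthSupp F (star (G.leg₁ β m k' (G.eFin J))))
      (Finset.mem_univ m)).trans (Finset.union_subset_right hK)

/-- With `c = cλ(e_J)` and `c' = λ(e_{J'})c'`, the product contains the values of `λ` on the legs of
`e_J` next to `λ(e_{J'})`, and (ii) kills these for almost all `β`. -/
theorem exists_psi_mul_eq_zero {c c' : G.EF F} (hc : c ∈ localAlg G F hG)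
    (hc' : c' ∈ localAlg G F hG) :
    ∃ S : Finset I, ∀ β ∉ S, ∀ k k', psi hG β c k k' * c' = 0 := by
  obtain ⟨J, hJ⟩ := hc
  obtain ⟨J', hJ'⟩ := hc'
  obtain ⟨S, hS⟩ := hG.finite_not_fOrth F (G.eFin J) (G.eFin J')
  refine ⟨S, fun β hβ k k' => ?_⟩
  rw [← (hJ J subset_rfl).2, ← (hJ' J' subset_rfl).1, psi_mul, Finset.sum_mul]
  refine Finset.sum_eq_zero fun m _ => ?_
  have h0 : G.lam F (G.leg₁ β m k' (G.eFin J)) * G.lam F (G.eFin J') = 0 :=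
    vanishes_lam 0 _ _ (hS β hβ m k') []
  rw [psi_lam, mul_assoc, ← mul_assoc _ _ c', h0, zero_mul, mul_zero]

theorem coe_eq_coeHom (x : G.EF F) :
    DoubleCentralizer.coe ℂ x = DoubleCentralizer.coeHom (𝕜 := ℂ) x := rfl

theorem condA1_deltaF {C₀ : NonUnitalStarSubalgebra ℂ (G.EF F)} (hle : C₀ ≤ localAlg G F hG)
    (hpsi : ∀ c ∈ C₀, ∀ β k k', psi hG β c k k' ∈ C₀) : CondA1 (deltaF hG) C₀ := by
  intro c hc c' hc'
  have hentry : ∀ β k k', ((deltaF hG c).1 β *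
      Matrix.diagonal fun _ => DoubleCentralizer.coe ℂ c' : Matrix _ _ 𝓜(ℂ, G.EF F)) k k'
      = DoubleCentralizer.coe ℂ (psi hG β c k k' * c') := by
    intro β k k'
    rw [Matrix.mul_diagonal, deltaF_apply, coe_eq_coeHom, coe_eq_coeHom, coe_eq_coeHom, map_mul]
  refine ⟨?_, fun β k k' => ⟨_, mul_mem (hpsi c hc β k k') hc', hentry β k k'⟩⟩
  obtain ⟨S, hS⟩ := exists_psi_mul_eq_zero hG (hle hc) (hle hc')
  refine S.finite_toSet.subset fun β hβ => ?_
  by_contra hn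
  refine hβ ?_
  refine Matrix.ext fun k k' => (hentry β k k').trans ?_
  rw [hS β hn, coe_eq_coeHom, map_zero]
  rfl

theorem condA2_deltaF {C₀ : NonUnitalStarSubalgebra ℂ (G.EF F)}
    (hpsi : ∀ c ∈ C₀, ∀ β k k', psi hG β c k k' ∈ C₀) : CondA2 (deltaF hG) C₀ := by
  intro c hc a
  refine ⟨?_, fun β k k' => ⟨∑ m, a.1 β m k' • psi hG β c k m,
    sum_mem fun m _ => SMulMemClass.smul_mem _ (hpsi c hc β k m), ?_⟩⟩
  · refine (supp a).finite_toSet.subset fun β hβ => ?_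
    refine Finset.mem_coe.2 (mem_supp.2 fun hn => hβ ?_)
    simp only [hn]
    rw [Matrix.map_zero _ (map_zero _), mul_zero]
  · change ((deltaF hG c).1 β * (a.1 β).map (algebraMap ℂ 𝓜(ℂ, G.EF F)) : Matrix _ _ _) k k' = _
    rw [coe_eq_coeHom, map_sum, Matrix.mul_apply]
    refine Finset.sum_congr rfl fun m _ => ?_
    rw [map_smul, Matrix.map_apply, ← Algebra.commutes, ← Algebra.smul_def]
    rfl

/-- A local unit `q` of `h²` is one of `h`, since `(h - hq)*(h - hq) = p - pq - qp + qpq = 0`. -/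
theorem mem_localAlg_of_mul_self {h p : G.EF F} (hh : star h = h) (hp : h * h = p)
    (hmem : p ∈ localAlg G F hG) : h ∈ localAlg G F hG := by
  obtain ⟨J, hJ⟩ := hmem
  refine ⟨J, fun K hK => ?_⟩
  obtain ⟨h1, h2⟩ := hJ K hK
  set q := G.lam F (G.eFin K) with hq
  have hqs : star q = q := by rw [hq, ← (relations_lam hG).map_star, star_eFin]
  have h0 : star (h - h * q) * (h - h * q) = 0 := by
    rw [star_sub, star_mul, hh, hqs, sub_mul, mul_sub, mul_sub, ← mul_assoc h h q, hp, h2,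
      mul_assoc q h h, hp, h1, mul_assoc q h (h * q), ← mul_assoc h h q, hp, h2, h1]
    simp
  have h3 : h * q = h := (sub_eq_zero.1 ((CStarRing.star_mul_self_eq_zero_iff _).1 h0)).symm
  refine ⟨?_, h3⟩
  have := congrArg star h3
  rwa [star_mul, hh, hqs] at this

end LocalUnits

/-! ### The condition A3 -/

section A3

attribute [local instance] CStarAlgebra.spectralOrder CStarAlgebra.spectralOrderedRing

variable {φ : G.A₀ →ₗ[ℂ] ℂ}

theorem lam_star_mul_self_nonneg (hG : G.IsDiscreteQuantumGroup) (y : G.A₀) :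
    0 ≤ G.lam F (star y * y) := by
  obtain ⟨z, hz⟩ := (relations_lam (F := F) hG).exists_star_mul y
  rw [hz]
  exact star_mul_self_nonneg z

theorem lam_sum_sliceA_nonneg (hG : G.IsDiscreteQuantumGroup) (hφ : G.IsLeftHaar φ)
    (b : G.A₀) (J : Finset I) : 0 ≤ G.lam F (∑ β ∈ J, sliceA φ (star b * b) β) := by
  rw [map_sum]
  refine Finset.sum_nonneg fun β _ => ?_
  obtain ⟨y, hy⟩ := hφ.sliceA_eq_sum b β
  rw [hy, map_sum]
  refine Finset.sum_nonneg fun l _ => ?_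
  rw [map_sum]
  exact Finset.sum_nonneg fun m _ => lam_star_mul_self_nonneg hG _

theorem exists_lam_sum_sliceA_mul (hG : G.IsDiscreteQuantumGroup) (hφ : G.IsLeftHaar φ)
    {b : G.A₀} (hb : φ (star b * b) = 1)
    (x : G.A₀) : ∃ S : Finset I, ∀ J, S ⊆ J →
      G.lam F (∑ β ∈ J, sliceA φ (star b * b) β) * G.lam F x = G.lam F x := by
  obtain ⟨S, hS⟩ := hφ.exists_sum_sliceA (star b * b) (hG.orthSupp F x)
  refine ⟨S, fun J hJ => (relations_lam hG).mul_eq_self hG fun γ hγ => ?_⟩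
  rw [hS J hJ γ hγ, hb, one_smul]

theorem norm_lam_sum_sliceA_le (hG : G.IsDiscreteQuantumGroup) (hφ : G.IsLeftHaar φ)
    {b : G.A₀} (hb : φ (star b * b) = 1)
    (J : Finset I) : ‖G.lam F (∑ β ∈ J, sliceA φ (star b * b) β)‖ ≤ 1 := by
  classical
  obtain ⟨S, hS⟩ := exists_lam_sum_sliceA_mul (F := F) hG hφ hb
    (∑ β ∈ J, sliceA φ (star b * b) β)
  -- The larger partial sum over `J ∪ S` dominates the one over `J` and acts on it as a unit, so the
  -- latter is a contraction.
  have h1 := hS (J ∪ S) Finset.subset_union_right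
  obtain ⟨z, hz⟩ := CStarAlgebra.nonneg_iff_eq_star_mul_self.1
    (lam_sum_sliceA_nonneg (F := F) hG hφ b J)
  obtain ⟨w, hw⟩ := CStarAlgebra.nonneg_iff_eq_star_mul_self.1
    (lam_sum_sliceA_nonneg (F := F) hG hφ b (S \ J))
  refine norm_le_one_of_mul_eq_self hz (w := w) ?_ h1
  rw [← hw, ← map_sub]
  congr 1
  rw [← Finset.union_sdiff_self_eq_union, Finset.sum_union Finset.disjoint_sdiff,
    add_sub_cancel_left]

/-- The partial sums are uniformly bounded and eventually fix each element of a dense subalgebra. -/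
theorem hasSum_lam_sliceA_mul (hG : G.IsDiscreteQuantumGroup) (hφ : G.IsLeftHaar φ)
    {b : G.A₀} (hb : φ (star b * b) = 1)
    (c : G.EF F) : HasSum (fun β => G.lam F (sliceA φ (star b * b) β) * c) c := by
  have hpart : ∀ (J : Finset I) (c : G.EF F), ∑ β ∈ J, G.lam F (sliceA φ (star b * b) β) * c
      = G.lam F (∑ β ∈ J, sliceA φ (star b * b) β) * c := by
    intro J c
    rw [map_sum, Finset.sum_mul]
  rw [HasSum, SummationFilter.unconditional_filter, Metric.tendsto_nhds]
  intro ε hε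
  obtain ⟨c₀, hc₀, hd⟩ := Metric.mem_closure_iff.1 (dense_EF₀ c) (ε / 2) (half_pos hε)
  obtain ⟨L, hL⟩ := EF₀_le_localAlg hG hc₀
  -- As `λ(e_L)` is a left unit for `c₀`, it suffices that the partial sums fix `λ(e_L)`.
  obtain ⟨S, hS⟩ := exists_lam_sum_sliceA_mul (F := F) hG hφ hb (G.eFin L)
  refine Filter.eventually_atTop.2 ⟨S, fun J hJ => ?_⟩
  have h0 : G.lam F (∑ β ∈ J, sliceA φ (star b * b) β) * c₀ = c₀ := by
    rw [← (hL L subset_rfl).1, ← mul_assoc, hS J hJ]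
  rw [hpart, dist_eq_norm]
  have hsplit : G.lam F (∑ β ∈ J, sliceA φ (star b * b) β) * c - c
      = G.lam F (∑ β ∈ J, sliceA φ (star b * b) β) * (c - c₀) - (c - c₀) := by
    rw [mul_sub, h0]
    abel
  rw [dist_eq_norm] at hd
  have hmul : ‖G.lam F (∑ β ∈ J, sliceA φ (star b * b) β) * (c - c₀)‖ ≤ ‖c - c₀‖ :=
    (norm_mul_le _ _).trans (mul_le_of_le_one_left (norm_nonneg _)
      (norm_lam_sum_sliceA_le hG hφ hb J))
  calc _ ≤ ‖G.lam F (∑ β ∈ J, sliceA φ (star b * b) β) * (c - c₀)‖ + ‖c - c₀‖ := by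
        rw [hsplit]
        exact norm_sub_le _ _
    _ < ε := by linarith

theorem slice_deltaF_lam (hG : G.IsDiscreteQuantumGroup) (a : G.A₀) (β : I) :
    slice φ (deltaF hG (G.lam F a)) β = DoubleCentralizer.coe ℂ (G.lam F (sliceA φ a β)) := by
  simp only [slice, deltaF_apply, psi_lam, sliceA, coe_eq_coeHom, map_sum, map_smul]

theorem sliceEqOne_deltaF (hG : G.IsDiscreteQuantumGroup) (hφ : G.IsLeftHaar φ)
    {b : G.A₀} (hb : φ (star b * b) = 1) :
    SliceEqOne φ (deltaF hG (G.lam F (star b * b))) := by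
  intro c
  simp only [slice_deltaF_lam]
  refine ⟨hasSum_lam_sliceA_mul hG hφ hb c, ?_⟩
  -- Multiplication from the other side follows by taking adjoints, the slices being self-adjoint.
  have h := (hasSum_lam_sliceA_mul hG hφ hb (star c)).star
  rw [star_star] at h
  have hsa : ∀ β, star (G.lam F (sliceA φ (star b * b) β)) = G.lam F (sliceA φ (star b * b) β) := by
    intro β
    have := lam_sum_sliceA_nonneg (F := F) hG hφ b {β}
    rw [Finset.sum_singleton] at this
    exact this.isSelfAdjoint.star_eq
  simp only [star_mul, star_star, hsa] at h
  exact h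

end A3

end Comultiplication

end

/-! ### The theorem -/

theorem theorem5p1p3 {I : Type u} (G : Comultiplication I) (hG : G.IsDiscreteQuantumGroup)
    (α₀ : I) (hα₀ : G.IsCounitIndex α₀)
    (φ : G.A₀ →ₗ[ℂ] ℂ) (hφ : G.IsLeftHaar φ) (hφ₀ : φ (AlgSum.e α₀) = 1)
    (F : Finset I) (hF : α₀ ∈ F) :
    ∃ δ : G.EF F →⋆ₙₐ[ℂ] G.MulTensor (G.EF F),
      (G.IsDeltaF F δ ∧ ∀ δ', G.IsDeltaF F δ' → δ' = δ) ∧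
      Comultiplication.IsCoassociative δ ∧
      -- the `*`-algebra generated by the elements `λ(a)`, and `λ(h₀)`
      Dense (G.EF₀ F : Set (G.EF F)) ∧
      Comultiplication.CondA1 δ (G.EF₀ F) ∧
      Comultiplication.CondA2 δ (G.EF₀ F) ∧
      (∃ z, G.lam F (AlgSum.e α₀) = star z * z) ∧
      Comultiplication.SliceEqOne φ (δ (G.lam F (AlgSum.e α₀))) ∧
      -- A1, A2, A3 for a dense `*`-subalgebra that contains it, with `h² = λ(h₀)`
      ∃ C₀ : NonUnitalStarSubalgebra ℂ (G.EF F),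
        G.EF₀ F ≤ C₀ ∧ Dense (C₀ : Set (G.EF F)) ∧
        Comultiplication.CondA1 δ C₀ ∧
        Comultiplication.CondA2 δ C₀ ∧
        ∃ h, Comultiplication.IsA3Element δ C₀ φ h ∧ h * h = G.lam F (AlgSum.e α₀) := by
  -- The slice lemmas need an element `b* b` with `φ(b* b) = 1`; the projection `h₀` is one, with `b
  -- = h₀`.
  have he : (AlgSum.e α₀ : G.A₀) = star (AlgSum.e α₀) * AlgSum.e α₀ :=
    (Comultiplication.e_star_mul α₀).symm
  have hslice : Comultiplication.SliceEqOne φ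
      (Comultiplication.deltaF hG (G.lam F (AlgSum.e α₀))) := by
    rw [he]
    exact Comultiplication.sliceEqOne_deltaF hG hφ (by rw [← he, hφ₀])
  let _ := CStarAlgebra.spectralOrder (G.EF F)
  have := CStarAlgebra.spectralOrderedRing (G.EF F)
  have hpos : 0 ≤ G.lam F (AlgSum.e α₀) := by
    rw [he]
    exact Comultiplication.lam_star_mul_self_nonneg hG _
  have hsq := CFC.sqrt_mul_sqrt_self (G.lam F (AlgSum.e α₀)) hpos
  have hsn := CFC.sqrt_nonneg (G.lam F (AlgSum.e α₀))
  refine ⟨Comultiplication.deltaF hG, ⟨Comultiplication.isDeltaF_deltaF hG, fun δ' h =>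
      Comultiplication.IsDeltaF.unique hG (Comultiplication.isDeltaF_deltaF hG) h⟩,
    Comultiplication.isCoassociative_deltaF hG, Comultiplication.dense_EF₀,
    Comultiplication.condA1_deltaF hG (Comultiplication.EF₀_le_localAlg hG) fun c hc =>
      Comultiplication.psi_mem_EF₀ hG hc,
    Comultiplication.condA2_deltaF hG fun c hc => Comultiplication.psi_mem_EF₀ hG hc,
    CStarAlgebra.nonneg_iff_eq_star_mul_self.1 hpos, hslice,
    Comultiplication.localAlg G F hG, Comultiplication.EF₀_le_localAlg hG,
    Comultiplication.dense_EF₀.mono (Comultiplication.EF₀_le_localAlg hG),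
    Comultiplication.condA1_deltaF hG le_rfl fun c hc => Comultiplication.psi_mem_localAlg hG hc,
    Comultiplication.condA2_deltaF hG fun c hc => Comultiplication.psi_mem_localAlg hG hc,
    CFC.sqrt (G.lam F (AlgSum.e α₀)), ⟨?_, CStarAlgebra.nonneg_iff_eq_star_mul_self.1 hsn, ?_⟩, hsq⟩
  · exact Comultiplication.mem_localAlg_of_mul_self hG hsn.isSelfAdjoint.star_eq hsq
      (Comultiplication.lam_mem_localAlg hG _)
  · rw [hsq]
    exact hslice
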